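/- Let $G=(V,E)$ be a fixed (public) finite undirected graph with $n=|V|$ vertices. The private input is a weight vector $w\in\mathbb{R}_{\ge 0}^{E}$, and two inputs $w,w'$ are neighbors if $\|w-w'\|_1\le 1$. Let $\mathrm{dist}_w(u,v)$ denote the minimum total weight of a path from $u$ to $v$ ($+\infty$ if there is none). An algorithm for all-pairs shortest path distances is a randomized map $M$ that assigns to each input $w$ a random family $(\widetilde{\mathrm{dist}}(u,v))_{u,v\in V}$ of extended real numbers. It is $(\varepsilon,\delta)$-DP if $\Pr[M(w)\in S]\le e^{\varepsilon}\Pr[M(w')\in S]+\delta$ for all neighbors $w,w'$ and all measurable sets $S$ of outputs. An output is $(\gamma,\alpha)$-accurate for $w$ if $\mathrm{dist}_w(u,v)-\alpha\le\widetilde{\mathrm{dist}}(u,v)\le\gamma\cdot\mathrm{dist}_w(u,v)+\alpha$ for all $u,v\in V$. Theorem. For every $c>0$ there is a constant $C=C(c)>0$ such that for every integer $k\ge 1$, all $\varepsilon,\delta\in(0,1)$ and every finite undirected graph $G$ with $n$ vertices, there is an $(\varepsilon,\delta)$-DP algorithm for all-pairs shortest path distances on $G$ whose output, on every input $w$, is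 $$\left(2k-1,\; C\cdot\frac{k\cdot n^{\frac{k+1}{3k+1}}(\log n)^{\frac{5k+2}{3k+1}}(\log(2/\delta))^{\frac{k}{3k+1}}}{\varepsilon}\right)\text{-accurate}$$ with probability at least $1-n^{-c}$. -/

import Mathlib

open scoped NNReal ENNReal

namespace PrivateAPSD

/-- The private input: a vector of nonnegative weights on the edges of the fixed, public graph `G`. -/
abbrev EdgeWeights {V : Type*} (G : SimpleGraph V) : Type _ := G.edgeSet → ℝ≥0

/-- Two weight vectors are neighbors if their `ℓ₁`-distance is at most `1`. -/
def Neighbors {V : Type*} {G : SimpleGraph V} [Fintype G.edgeSet] (w w' : EdgeWeights G) : Prop :=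
  ∑ e, |(w e : ℝ) - (w' e : ℝ)| ≤ 1

/-- The total weight of a walk (edges counted with multiplicity). -/
def walkWeight {V : Type*} {G : SimpleGraph V} (w : EdgeWeights G) :
    {u v : V} → G.Walk u v → ℝ≥0
  | _, _, .nil => 0
  | _, _, .cons h p => w ⟨s(_, _), h⟩ + walkWeight w p

/-- The shortest-path distance from `u` to `v`; it is `∞` if there is no path. Since weights are
nonnegative, closed detours never help, and the infimum over walks is the minimum over paths. -/
noncomputable def wdist {V : Type*} {G : SimpleGraph V} (w : EdgeWeights G) (u v : V) : ℝ≥0∞ :=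
  ⨅ p : G.Walk u v, (walkWeight w p : ℝ≥0∞)

/-- An output of an algorithm for all-pairs shortest path distances: an estimate of the distance
for every pair of vertices (extended reals, so that `∞` can be reported for unreachable pairs). -/
abbrev Estimate (V : Type*) : Type _ := V → V → EReal

/-- `(γ, α)`-accuracy: `dist u v - α ≤ est u v ≤ γ * dist u v + α` for all vertices `u, v`. -/
def IsAccurate {V : Type*} {G : SimpleGraph V} (w : EdgeWeights G) (γ α : ℝ)
    (est : Estimate V) : Prop :=
  ∀ u v : V, (wdist w u v : EReal) - (α : EReal) ≤ est u v ∧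
    est u v ≤ (γ : EReal) * (wdist w u v : EReal) + (α : EReal)

/-- A randomized algorithm, given by its output distribution on each input, is
`(ε, δ)`-differentially private with respect to the neighboring relation `nbr`. -/
def IsDP {X Ω : Type*} [MeasurableSpace Ω] (nbr : X → X → Prop) (ε δ : ℝ)
    (M : X → MeasureTheory.ProbabilityMeasure Ω) : Prop :=
  ∀ x x' : X, nbr x x' → ∀ S : Set Ω, MeasurableSet S →
    (M x : MeasureTheory.Measure Ω) S ≤
      ENNReal.ofReal (Real.exp ε) * (M x' : MeasureTheory.Measure Ω) S + ENNReal.ofReal δ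

/-- The additive error
`k * n^((k+1)/(3k+1)) * (log n)^((5k+2)/(3k+1)) * (log (2/δ))^(k/(3k+1)) / ε`. -/
noncomputable def additiveError (k n : ℕ) (ε δ : ℝ) : ℝ :=
  (k : ℝ) * (n : ℝ) ^ (((k : ℝ) + 1) / (3 * (k : ℝ) + 1))
    * Real.log (n : ℝ) ^ ((5 * (k : ℝ) + 2) / (3 * (k : ℝ) + 1))
    * Real.log (2 / δ) ^ ((k : ℝ) / (3 * (k : ℝ) + 1)) / ε

end PrivateAPSD

/-! The algorithm samples about `s` random hubs and releases two things. The first is a noisy copy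
of every edge weight, with error of order `log n / ε`, used only along stretches of at most about `h
= n log n / s` edges. The second is a sparse graph approximating the distances between hubs. A long
shortest path has `h + 1` vertices at each end, and with high probability the hubs hit both ends;
the path is then a short piece, a hub-to-hub piece and a short piece. The short pieces cost `h log n
/ ε`.

The hub distances come from a private version of the greedy spanner. Each step runs an exponential
mechanism over the hub pairs not yet joined by fewer than `2k` spanner edges; it selects a nearly
closest pair together with an integer approximation of its scaled distance, and adds that edge. The
girth stays above `2k`, so the Moore bound (`NoShortcut.adjCount_le`) limits the number of edges to
about `s^(1+1/k)`, and hence the number `T` of steps needed. When a pair becomes joined by a short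
path, all edges chosen so far are nearly no longer than its own distance, so at most `2k - 1` of
them give stretch `2k - 1` (`GreedyInv.exists_walk`, `GreedyInv.wdist_le_mul`).

For privacy, every hub distance is 1-Lipschitz in `w` for the `ℓ₁` norm (`abs_wdist_sub_le`). A
Hoeffding-type bound on Rényi divergence (`PureClose.tsum_rpow_le`), multiplicative under adaptive
composition (`RenyiClose.bind`), makes `T` selections cost only a factor `√(T log(2/δ))`. The
spanner error is thus of order `k log n √(T log(2/δ)) / ε`. Choosing `s = (n log n /
√log(2/δ))^(2k/(3k+1))`, up to rounding, balances the two errors. -/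

namespace PrivateAPSD

/-! ### Failure probabilities and divergences of discrete distributions -/

section Probability

variable {X Y : Type*}

/-- The event `good` fails with probability at most `β`. -/
def WHP (β : ℝ≥0∞) (P : PMF X) (good : X → Prop) : Prop :=
  P.toOuterMeasure {x | ¬ good x} ≤ β

theorem WHP.mono {β β' : ℝ≥0∞} {P : PMF X} {A B : X → Prop} (h : WHP β P A) (hβ : β ≤ β')
    (hAB : ∀ x, A x → B x) : WHP β' P B :=
  (P.toOuterMeasure.mono fun x (hx : ¬ B x) (hA : A x) => hx (hAB x hA)).trans (h.trans hβ)

theorem WHP.of_forall (β : ℝ≥0∞) (P : PMF X) {A : X → Prop} (h : ∀ x, A x) : WHP β P A :=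
  (P.toOuterMeasure.mono (s₂ := ∅) fun x (hx : ¬ A x) => hx (h x)).trans (by simp)

theorem WHP.pure (β : ℝ≥0∞) {x : X} {A : X → Prop} (h : A x) : WHP β (PMF.pure x) A := by
  simp [WHP, PMF.toOuterMeasure_pure_apply, h]

theorem WHP.bind {β₁ β₂ : ℝ≥0∞} {P : PMF X} {f : X → PMF Y} {A : X → Prop} {B : Y → Prop}
    (hP : WHP β₁ P A) (hf : ∀ x, A x → WHP β₂ (f x) B) : WHP (β₁ + β₂) (P.bind f) B := by
  unfold WHP at *
  rw [PMF.toOuterMeasure_bind_apply]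
  calc ∑' x, P x * (f x).toOuterMeasure {y | ¬ B y}
      ≤ ∑' x, ({x | ¬ A x}.indicator P x + P x * β₂) := by
        refine ENNReal.tsum_le_tsum fun x => ?_
        by_cases hx : A x
        · simpa [hx] using mul_le_mul_right (hf x hx) (P x)
        · have : (f x).toOuterMeasure {y | ¬ B y} ≤ 1 := by
            rw [PMF.toOuterMeasure_apply, ← (f x).tsum_coe]
            exact ENNReal.tsum_le_tsum fun y => Set.indicator_le_self _ _ y
          simp only [Set.indicator, Set.mem_ofPred_eq, hx, not_false_eq_true, if_true]
          calc P x * _ ≤ P x * 1 := mul_le_mul_right this _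
            _ ≤ _ := by rw [mul_one]; exact le_self_add
    _ ≤ β₁ + β₂ := by
        rw [ENNReal.tsum_add, ENNReal.tsum_mul_right, P.tsum_coe, one_mul,
          ← PMF.toOuterMeasure_apply]
        gcongr

theorem WHP.map {β : ℝ≥0∞} {P : PMF X} {f : X → Y} {B : Y → Prop}
    (hP : WHP β P (fun x => B (f x))) : WHP β (P.map f) B := by
  unfold WHP at *
  rwa [PMF.toOuterMeasure_map_apply]

theorem WHP.and {β₁ β₂ : ℝ≥0∞} {P : PMF X} {A B : X → Prop} (hA : WHP β₁ P A)
    (hB : WHP β₂ P B) : WHP (β₁ + β₂) P (fun x => A x ∧ B x) := by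
  refine (P.toOuterMeasure.mono (s₂ := {x | ¬ A x} ∪ {x | ¬ B x})
    fun x (hx : ¬ (A x ∧ B x)) => ?_).trans
    ((MeasureTheory.measure_union_le _ _).trans (add_le_add hA hB))
  by_cases h : A x
  · exact Or.inr fun hb => hx ⟨h, hb⟩
  · exact Or.inl h

theorem WHP.forall {ι : Type*} [Fintype ι] {β : ℝ≥0∞} {P : PMF X} {A : ι → X → Prop}
    (h : ∀ i, WHP β P (A i)) : WHP (Fintype.card ι * β) P (fun x => ∀ i, A i x) := by
  have hset : {x | ¬ ∀ i, A i x} = ⋃ i, {x | ¬ A i x} := by ext x; simp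
  unfold WHP
  rw [hset]
  calc P.toOuterMeasure (⋃ i, {x | ¬ A i x}) ≤ ∑ i, P.toOuterMeasure {x | ¬ A i x} :=
        MeasureTheory.measure_iUnion_fintype_le _ _
    _ ≤ ∑ _i : ι, β := Finset.sum_le_sum fun i _ => h i
    _ = _ := by simp

/-- The outer measure of a mass function is at most its measure on every set, so the event need not
be measurable. -/
theorem WHP.one_sub_le_toMeasure [MeasurableSpace X] {β : ℝ} {P : PMF X} {A : X → Prop}
    (hβ : 0 ≤ β) (h : WHP (ENNReal.ofReal β) P A) :
    ENNReal.ofReal (1 - β) ≤ P.toMeasure {x | A x} := by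
  refine le_trans ?_ (P.toOuterMeasure_apply_le_toMeasure_apply _)
  rw [ENNReal.ofReal_sub _ hβ, ENNReal.ofReal_one]
  refine tsub_le_iff_right.2 ?_
  calc (1 : ℝ≥0∞) = P.toOuterMeasure ({x | A x} ∪ {x | ¬ A x}) := by
        rw [eq_comm, PMF.toOuterMeasure_apply_eq_one_iff]
        intro x _
        by_cases hx : A x <;> simp [hx]
    _ ≤ _ := (MeasureTheory.measure_union_le _ _).trans (add_le_add le_rfl h)

/-- Pointwise domination of probability mass functions up to a factor `exp c`. -/
def PureClose (c : ℝ) (P Q : PMF X) : Prop := ∀ x, P x ≤ ENNReal.ofReal (Real.exp c) * Q x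

theorem PureClose.mono {c c' : ℝ} {P Q : PMF X} (h : PureClose c P Q) (hc : c ≤ c') :
    PureClose c' P Q := fun x => (h x).trans (by gcongr)

theorem PureClose.refl (P : PMF X) : PureClose 0 P P := fun x => by simp

theorem PureClose.bind {c₁ c₂ : ℝ} {P Q : PMF X} {f g : X → PMF Y} (h : PureClose c₁ P Q)
    (hf : ∀ x, PureClose c₂ (f x) (g x)) : PureClose (c₁ + c₂) (P.bind f) (Q.bind g) := by
  intro y
  rw [PMF.bind_apply, PMF.bind_apply, ← ENNReal.tsum_mul_left]
  refine ENNReal.tsum_le_tsum fun x => ?_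
  calc P x * f x y ≤ (ENNReal.ofReal (Real.exp c₁) * Q x) *
        (ENNReal.ofReal (Real.exp c₂) * g x y) := mul_le_mul' (h x) (hf x y)
    _ = _ := by
      rw [Real.exp_add, ENNReal.ofReal_mul (Real.exp_nonneg _)]
      ring

theorem PureClose.map {c : ℝ} {P Q : PMF X} (f : X → Y) (h : PureClose c P Q) :
    PureClose c (P.map f) (Q.map f) := by
  rw [← PMF.bind_pure_comp, ← PMF.bind_pure_comp]
  simpa using h.bind (f := PMF.pure ∘ f) (g := PMF.pure ∘ f) (fun x => PureClose.refl (PMF.pure (f x)))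

/-- A dual form of a bound on the Rényi divergence of order `p`, where `q` is the exponent
conjugate to `p`. -/
def RenyiClose (q : ℝ) (K : ℝ≥0∞) (P Q : PMF X) : Prop :=
  ∀ f : X → ℝ≥0∞, ∑' x, P x * f x ≤ K * (∑' x, Q x * f x ^ q) ^ (1 / q)

theorem RenyiClose.mono {q : ℝ} {K K' : ℝ≥0∞} {P Q : PMF X} (h : RenyiClose q K P Q)
    (hK : K ≤ K') : RenyiClose q K' P Q := fun f => (h f).trans (by gcongr)

theorem RenyiClose.pure {q : ℝ} (hq : 0 < q) (x : X) :
    RenyiClose q 1 (PMF.pure x) (PMF.pure x) := by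
  intro f
  rw [tsum_eq_single x (by intro y hy; simp [PMF.pure_apply, hy]),
    tsum_eq_single x (by intro y hy; simp [PMF.pure_apply, hy])]
  simp [← ENNReal.rpow_mul, hq.ne']

/-- This is adaptive composition and the reason for the dual form: the inner bound produces the
`L^q` norm of the test function under `g x`, which then serves as the test function for the outer
bound. -/
theorem RenyiClose.bind {q : ℝ} (hq : 0 < q) {K₁ K₂ : ℝ≥0∞} {P Q : PMF X} {f g : X → PMF Y}
    (h : RenyiClose q K₁ P Q) (hf : ∀ x, RenyiClose q K₂ (f x) (g x)) :
    RenyiClose q (K₁ * K₂) (P.bind f) (Q.bind g) := by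
  have swap : ∀ (P : PMF X) (f : X → PMF Y) (F : Y → ℝ≥0∞),
      ∑' y, P.bind f y * F y = ∑' x, P x * ∑' y, f x y * F y := by
    intro P f F
    simp_rw [PMF.bind_apply, ← ENNReal.tsum_mul_right, ← ENNReal.tsum_mul_left]
    rw [ENNReal.tsum_comm]
    simp_rw [mul_assoc]
  intro F
  rw [swap, swap]
  calc ∑' x, P x * ∑' y, f x y * F y
      ≤ ∑' x, K₂ * (P x * (∑' y, g x y * F y ^ q) ^ (1 / q)) := by
        refine ENNReal.tsum_le_tsum fun x => ?_
        calc _ ≤ P x * (K₂ * (∑' y, g x y * F y ^ q) ^ (1 / q)) := mul_le_mul_right (hf x F) _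
          _ = _ := by ring
    _ = K₂ * ∑' x, P x * (∑' y, g x y * F y ^ q) ^ (1 / q) := ENNReal.tsum_mul_left
    _ ≤ K₂ * (K₁ * (∑' x, Q x * ((∑' y, g x y * F y ^ q) ^ (1 / q)) ^ q) ^ (1 / q)) :=
        mul_le_mul_right (h _) _
    _ = _ := by
        simp_rw [← ENNReal.rpow_mul, one_div_mul_cancel hq.ne', ENNReal.rpow_one]
        ring

theorem RenyiClose.map {q : ℝ} {K : ℝ≥0∞} {P Q : PMF X} (g : X → Y) (h : RenyiClose q K P Q) :
    RenyiClose q K (P.map g) (Q.map g) := by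
  have swap : ∀ (P : PMF X) (F : Y → ℝ≥0∞), ∑' y, P.map g y * F y = ∑' x, P x * F (g x) := by
    intro P F
    simp_rw [← PMF.bind_pure_comp, PMF.bind_apply, ← ENNReal.tsum_mul_right]
    rw [ENNReal.tsum_comm]
    refine tsum_congr fun x => ?_
    rw [tsum_eq_single (g x) (by intro y hy; simp [PMF.pure_apply, hy])]
    simp
  intro F
  rw [swap, swap]
  exact h _

/-- The power function on `[1 - b, 1 + b]` lies below a chord of an exponential, as in the proof of
Hoeffding's lemma. -/
theorem rpow_le_chord {a b r : ℝ} (ha : 0 < a) (hb : 0 < b) (hr : 0 ≤ r) (hr1 : 1 - b ≤ r)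
    (hr2 : r ≤ 1 + b) :
    r ^ a + Real.sinh (a * b) / b ≤ Real.cosh (a * b) + Real.sinh (a * b) / b * r := by
  have h1 : r ^ a ≤ Real.exp (a * (r - 1)) := by
    rcases hr.eq_or_lt with rfl | hr0
    · rw [Real.zero_rpow ha.ne']; positivity
    · rw [Real.rpow_def_of_pos hr0]
      apply Real.exp_le_exp.2
      nlinarith [Real.log_le_sub_one_of_pos hr0]
  have h2 : Real.exp (a * (r - 1)) ≤
      (1 - (r - 1) / b) / 2 * Real.exp (-(a * b)) + (1 + (r - 1) / b) / 2 * Real.exp (a * b) := by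
    have hx1 : -1 ≤ (r - 1) / b := by rw [le_div_iff₀ hb]; linarith
    have hx2 : (r - 1) / b ≤ 1 := by rw [div_le_iff₀ hb]; linarith
    have := convexOn_exp.2 (Set.mem_univ (-(a * b))) (Set.mem_univ (a * b))
      (show 0 ≤ (1 - (r - 1) / b) / 2 by linarith) (show 0 ≤ (1 + (r - 1) / b) / 2 by linarith)
      (by ring)
    simp only [smul_eq_mul] at this
    have e : (1 - (r - 1) / b) / 2 * -(a * b) + (1 + (r - 1) / b) / 2 * (a * b) = a * (r - 1) := by
      field_simp
      ring
    rwa [e] at this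
  rw [Real.cosh_eq, Real.sinh_eq]
  have h3 : (1 - (r - 1) / b) / 2 * Real.exp (-(a * b)) + (1 + (r - 1) / b) / 2 * Real.exp (a * b) =
    (Real.exp (a * b) + Real.exp (-(a * b))) / 2 +
      ((Real.exp (a * b) - Real.exp (-(a * b))) / 2) / b * r
       - ((Real.exp (a * b) - Real.exp (-(a * b))) / 2) / b := by
    field_simp
    ring
  linarith

/-- Under `Q` the likelihood ratio `P / Q` has mean one and lies in `[1 - b, 1 + b]` with `b = exp η
- 1`. Averaging the chord bound cancels its linear terms and leaves `cosh (a * b) ≤ exp ((a * b)² /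
2)`. The quadratic dependence on `η` is what beats basic composition. -/
theorem PureClose.tsum_rpow_le {η a : ℝ} (hη : 0 < η) (ha : 1 ≤ a) {P Q : PMF X}
    (h₁ : PureClose η P Q) (h₂ : PureClose η Q P) :
    ∑' x, Q x * (P x / Q x) ^ a ≤
      ENNReal.ofReal (Real.exp (a ^ 2 * (Real.exp η - 1) ^ 2 / 2)) := by
  set b := Real.exp η - 1 with hb
  have hb0 : 0 < b := by simp [hb, hη]
  have ha0 : 0 < a := by linarith
  set B := ENNReal.ofReal (Real.sinh (a * b) / b) with hB
  have hs : 0 ≤ Real.sinh (a * b) / b :=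
    div_nonneg (Real.sinh_nonneg_iff.2 (by positivity)) hb0.le
  have key : ∀ x, Q x * (P x / Q x) ^ a + Q x * B ≤
      Q x * ENNReal.ofReal (Real.cosh (a * b)) + B * P x := by
    intro x
    by_cases hQ : Q x = 0
    · have : P x = 0 := by simpa [hQ] using h₁ x
      simp [hQ]
    have hQt : Q x ≠ ⊤ := Q.apply_ne_top x
    have hPt : P x ≠ ⊤ := P.apply_ne_top x
    have hQp : 0 < (Q x).toReal := ENNReal.toReal_pos hQ hQt
    set r := (P x).toReal / (Q x).toReal with hr
    have hr0 : 0 ≤ r := by positivity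
    have hPQ : P x / Q x = ENNReal.ofReal r := by
      rw [hr, ENNReal.ofReal_div_of_pos hQp, ENNReal.ofReal_toReal hPt, ENNReal.ofReal_toReal hQt]
    have hP : P x = Q x * ENNReal.ofReal r := by
      rw [← hPQ, ENNReal.mul_div_cancel hQ hQt]
    have e1 : (P x).toReal ≤ Real.exp η * (Q x).toReal := by
      have := ENNReal.toReal_mono (ENNReal.mul_ne_top ENNReal.ofReal_ne_top hQt) (h₁ x)
      rwa [ENNReal.toReal_mul, ENNReal.toReal_ofReal (Real.exp_nonneg _)] at this
    have e2 : (Q x).toReal ≤ Real.exp η * (P x).toReal := by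
      have := ENNReal.toReal_mono (ENNReal.mul_ne_top ENNReal.ofReal_ne_top hPt) (h₂ x)
      rwa [ENNReal.toReal_mul, ENNReal.toReal_ofReal (Real.exp_nonneg _)] at this
    have hr2 : r ≤ 1 + b := by
      rw [hr, div_le_iff₀ hQp, hb]; linarith
    have hr3 : Real.exp (-η) ≤ r := by
      rw [hr, le_div_iff₀ hQp, Real.exp_neg]
      rw [inv_mul_le_iff₀ (Real.exp_pos _)]
      exact e2
    have hr1 : 1 - b ≤ r := by
      have : 2 ≤ Real.exp η + Real.exp (-η) := by
        have := Real.add_one_le_exp η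
        have := Real.add_one_le_exp (-η)
        linarith
      rw [hb]; linarith
    have hc := rpow_le_chord ha0 hb0 hr0 hr1 hr2
    rw [hPQ, hP, ENNReal.ofReal_rpow_of_nonneg hr0 ha0.le, mul_left_comm B, ← mul_add, ← mul_add]
    refine mul_le_mul_right ?_ _
    rw [hB, ← ENNReal.ofReal_mul hs, ← ENNReal.ofReal_add (by positivity) hs,
      ← ENNReal.ofReal_add (Real.cosh_pos _).le (by positivity)]
    exact ENNReal.ofReal_le_ofReal hc
  have hsum := ENNReal.tsum_le_tsum key
  rw [ENNReal.tsum_add, ENNReal.tsum_add, ENNReal.tsum_mul_right, ENNReal.tsum_mul_right,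
    ENNReal.tsum_mul_left, P.tsum_coe, Q.tsum_coe, one_mul, one_mul, mul_one] at hsum
  have hBt : B ≠ ⊤ := ENNReal.ofReal_ne_top
  refine (ENNReal.le_of_add_le_add_right hBt hsum).trans (ENNReal.ofReal_le_ofReal ?_)
  rw [← mul_pow]
  exact Real.cosh_le_exp_half_sq _

/-- Hölder's inequality for the factorization `P f = (Q^(1/a) P/Q) (Q^(1/q) f)`; points with `Q x =
0` also have `P x = 0`. -/
theorem PureClose.renyiClose {η a q : ℝ} (hη : 0 < η) (haq : a.HolderConjugate q) {P Q : PMF X}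
    (h₁ : PureClose η P Q) (h₂ : PureClose η Q P) :
    RenyiClose q (ENNReal.ofReal (Real.exp (a * (Real.exp η - 1) ^ 2 / 2))) P Q := by
  intro f
  have ha : 1 ≤ a := haq.lt.le
  have ha0 := haq.pos
  have hq0 := haq.symm.pos
  let _ : MeasurableSpace X := ⊤
  have hmeas : ∀ g : X → ℝ≥0∞, AEMeasurable g MeasureTheory.Measure.count :=
    fun g => measurable_from_top.aemeasurable
  have hold := ENNReal.lintegral_mul_le_Lp_mul_Lq MeasureTheory.Measure.count haq
    (hmeas fun x => Q x ^ (1 / a) * (P x / Q x)) (hmeas fun x => Q x ^ (1 / q) * f x)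
  simp only [MeasureTheory.lintegral_count, Pi.mul_apply] at hold
  have e0 : ∀ x, Q x ^ (1 / a) * (P x / Q x) * (Q x ^ (1 / q) * f x) = P x * f x := by
    intro x
    have hQt : Q x ≠ ⊤ := Q.apply_ne_top x
    by_cases hQ : Q x = 0
    · have : P x = 0 := by simpa [hQ] using h₁ x
      simp [this]
    · have : Q x ^ (1 / a) * Q x ^ (1 / q) = Q x := by
        rw [← ENNReal.rpow_add _ _ hQ hQt]
        have := haq.inv_add_inv_eq_one
        simp only [one_div]
        rw [this, ENNReal.rpow_one]
      calc _ = (Q x ^ (1 / a) * Q x ^ (1 / q)) * (P x / Q x) * f x := by ring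
        _ = _ := by rw [this, ENNReal.mul_div_cancel hQ hQt]
  have e1 : ∀ x, (Q x ^ (1 / a) * (P x / Q x)) ^ a = Q x * (P x / Q x) ^ a := by
    intro x
    rw [ENNReal.mul_rpow_of_nonneg _ _ ha0.le, ← ENNReal.rpow_mul, one_div_mul_cancel ha0.ne',
      ENNReal.rpow_one]
  have e2 : ∀ x, (Q x ^ (1 / q) * f x) ^ q = Q x * f x ^ q := by
    intro x
    rw [ENNReal.mul_rpow_of_nonneg _ _ hq0.le, ← ENNReal.rpow_mul, one_div_mul_cancel hq0.ne',
      ENNReal.rpow_one]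
  simp_rw [e0, e1, e2] at hold
  refine hold.trans (mul_le_mul_left ?_ _)
  calc _ ≤ (ENNReal.ofReal (Real.exp (a ^ 2 * (Real.exp η - 1) ^ 2 / 2))) ^ (1 / a) :=
        ENNReal.rpow_le_rpow (h₁.tsum_rpow_le hη ha h₂) (by positivity)
    _ = _ := by
        rw [ENNReal.ofReal_rpow_of_pos (Real.exp_pos _), ← Real.exp_mul]
        congr 2
        field_simp

/-- Conversion from a Rényi bound to an approximate differential privacy bound. -/
theorem RenyiClose.toOuterMeasure_le {a q κ ε δ : ℝ} (haq : a.HolderConjugate q) (hδ : 0 < δ)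
    {P Q : PMF X} (h : RenyiClose q (ENNReal.ofReal (Real.exp κ)) P Q)
    (hκ : κ ≤ ε / q - Real.log (1 / δ) / a) (S : Set X) :
    P.toOuterMeasure S ≤ ENNReal.ofReal (Real.exp ε) * Q.toOuterMeasure S + ENNReal.ofReal δ := by
  have ha0 := haq.pos
  have hq0 := haq.symm.pos
  have hS := h (S.indicator 1)
  have e1 : ∀ x, P x * S.indicator 1 x = S.indicator P x := by
    intro x; by_cases hx : x ∈ S <;> simp [hx]
  have e2 : ∀ x, Q x * (S.indicator (1 : X → ℝ≥0∞) x) ^ q = S.indicator Q x := by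
    intro x; by_cases hx : x ∈ S <;> simp [hx, hq0]
  simp_rw [e1, e2, ← PMF.toOuterMeasure_apply] at hS
  refine hS.trans ?_
  have hQt : Q.toOuterMeasure S ≠ ⊤ := by
    rw [PMF.toOuterMeasure_apply]; exact Q.tsum_coe_indicator_ne_top S
  obtain ⟨y, hy0, hy⟩ : ∃ y : ℝ, 0 ≤ y ∧ Q.toOuterMeasure S = ENNReal.ofReal y :=
    ⟨_, ENNReal.toReal_nonneg, (ENNReal.ofReal_toReal hQt).symm⟩
  rw [hy, ENNReal.ofReal_rpow_of_nonneg hy0 (by positivity), ← ENNReal.ofReal_mul (by positivity),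
    ← ENNReal.ofReal_mul (by positivity), ← ENNReal.ofReal_add (by positivity) hδ.le]
  refine ENNReal.ofReal_le_ofReal ?_
  have hw := haq.inv_add_inv_eq_one
  -- The hypothesis on `κ` turns the bound into a weighted geometric mean of `exp ε * y` and `δ`;
  -- the arithmetic mean separates them into the two terms of approximate privacy.
  have am := Real.geom_mean_le_arith_mean2_weighted (w₁ := q⁻¹) (w₂ := a⁻¹)
    (p₁ := Real.exp ε * y) (p₂ := δ) (by positivity) (by positivity) (by positivity) hδ.le
    (by linarith)
  have hz : 0 ≤ Real.exp ε * y := by positivity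
  have hq1 : q⁻¹ ≤ 1 := by have : 0 < a⁻¹ := by positivity
                           linarith
  have ha1 : a⁻¹ ≤ 1 := by have : 0 < q⁻¹ := by positivity
                           linarith
  calc Real.exp κ * y ^ (1 / q) ≤ Real.exp (ε / q - Real.log (1 / δ) / a) * y ^ (1 / q) := by
        gcongr
    _ = (Real.exp ε * y) ^ q⁻¹ * δ ^ a⁻¹ := by
        rw [Real.mul_rpow (Real.exp_nonneg _) hy0, ← Real.exp_mul, Real.rpow_def_of_pos hδ,
          mul_right_comm, ← Real.exp_add, one_div q]
        congr 2
        rw [one_div δ, Real.log_inv]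
        ring
    _ ≤ q⁻¹ * (Real.exp ε * y) + a⁻¹ * δ := am
    _ ≤ _ := by nlinarith

end Probability

/-! ### The exponential mechanism with integer-valued readings -/

section ExponentialMechanism

variable {R : Type*}

/-- The unnormalized weight of the pair `(r, j)` in the exponential mechanism that selects an
approximate minimizer `r` of `x` together with an approximation `j` of `x r`. -/
noncomputable def selWeight (x : R → ℝ) (p : R × ℕ) : ℝ≥0∞ :=
  ENNReal.ofReal (Real.exp (-(2 * |x p.1 - p.2| + p.2)))

theorem tsum_selWeight_ne_zero [Nonempty R] (x : R → ℝ) : ∑' p, selWeight x p ≠ 0 := by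
  obtain ⟨r⟩ := ‹Nonempty R›
  intro h
  have := ENNReal.tsum_eq_zero.1 h (r, 0)
  simp only [selWeight, ENNReal.ofReal_eq_zero] at this
  exact absurd this (not_le.2 (Real.exp_pos _))

theorem tsum_ofReal_exp_neg_mul (c : ℝ) :
    ∑' j : ℕ, ENNReal.ofReal (Real.exp (-(c * j))) = (1 - ENNReal.ofReal (Real.exp (-c)))⁻¹ := by
  rw [← ENNReal.tsum_geometric]
  refine tsum_congr fun j => ?_
  rw [← ENNReal.ofReal_pow (Real.exp_nonneg _), ← Real.exp_nat_mul]
  congr 2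
  ring

theorem tsum_ofReal_exp_neg_mul_le (c : ℝ) (hc : 0 < c) {B : ℝ} (hB : (1 - Real.exp (-c))⁻¹ ≤ B) :
    ∑' j : ℕ, ENNReal.ofReal (Real.exp (-(c * j))) ≤ ENNReal.ofReal B := by
  have h : 0 < 1 - Real.exp (-c) := by simp [hc]
  rw [tsum_ofReal_exp_neg_mul c, ← ENNReal.ofReal_one, ← ENNReal.ofReal_sub _ (Real.exp_nonneg _),
    ← ENNReal.ofReal_inv_of_pos h]
  exact ENNReal.ofReal_le_ofReal hB

theorem tsum_selWeight_ne_top [Fintype R] (x : R → ℝ) : ∑' p, selWeight x p ≠ ⊤ := by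
  rw [ENNReal.tsum_prod' (f := selWeight x), tsum_fintype]
  refine (ENNReal.sum_lt_top.2 fun r _ => ?_).ne
  refine lt_of_le_of_lt (ENNReal.tsum_le_tsum fun j => ENNReal.ofReal_le_ofReal
    (Real.exp_le_exp.2 ?_)) (lt_of_le_of_lt (tsum_ofReal_exp_neg_mul_le 1 one_pos le_rfl)
      ENNReal.ofReal_lt_top)
  have := abs_nonneg (x r - j)
  linarith

/-- The exponential mechanism selecting an approximate minimizer of `x` and its rounded value. -/
noncomputable def expMech [Fintype R] [Nonempty R] (x : R → ℝ) : PMF (R × ℕ) :=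
  PMF.normalize (selWeight x) (tsum_selWeight_ne_zero x) (tsum_selWeight_ne_top x)

theorem selWeight_le {x x' : R → ℝ} {η : ℝ} (h : ∀ r, |x r - x' r| ≤ η) (p : R × ℕ) :
    selWeight x p ≤ ENNReal.ofReal (Real.exp (2 * η)) * selWeight x' p := by
  unfold selWeight
  rw [← ENNReal.ofReal_mul (Real.exp_nonneg _), ← Real.exp_add]
  refine ENNReal.ofReal_le_ofReal (Real.exp_le_exp.2 ?_)
  have h1 : |x' p.1 - p.2| ≤ |x p.1 - x' p.1| + |x p.1 - p.2| := by
    have := abs_sub_le (x' p.1) (x p.1) p.2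
    rwa [abs_sub_comm (x' p.1) (x p.1)] at this
  linarith [h p.1]

/-- Half of the exponent `4 * η` comes from the weights and half from the normalizing sum. -/
theorem expMech_pureClose [Fintype R] [Nonempty R] {x x' : R → ℝ} {η : ℝ}
    (h : ∀ r, |x r - x' r| ≤ η) : PureClose (4 * η) (expMech x) (expMech x') := by
  intro p
  unfold expMech
  rw [PMF.normalize_apply, PMF.normalize_apply]
  have hZ : (∑' p, selWeight x p)⁻¹ ≤
      ENNReal.ofReal (Real.exp (2 * η)) * (∑' p, selWeight x' p)⁻¹ := by
    have h1 : ∑' p, selWeight x' p ≤ ENNReal.ofReal (Real.exp (2 * η)) * ∑' p, selWeight x p := by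
      rw [← ENNReal.tsum_mul_left]
      exact ENNReal.tsum_le_tsum fun p => selWeight_le (fun r => by rw [abs_sub_comm]; exact h r) p
    have hE0 : ENNReal.ofReal (Real.exp (2 * η)) ≠ 0 := by simp [Real.exp_pos]
    rw [← ENNReal.inv_le_inv] at h1
    rw [ENNReal.mul_inv (Or.inl hE0) (Or.inl ENNReal.ofReal_ne_top)] at h1
    calc (∑' p, selWeight x p)⁻¹ = ENNReal.ofReal (Real.exp (2 * η)) *
          ((ENNReal.ofReal (Real.exp (2 * η)))⁻¹ * (∑' p, selWeight x p)⁻¹) := by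
          rw [← mul_assoc, ENNReal.mul_inv_cancel hE0 ENNReal.ofReal_ne_top, one_mul]
      _ ≤ _ := mul_le_mul_right h1 _
  calc selWeight x p * (∑' p, selWeight x p)⁻¹
      ≤ (ENNReal.ofReal (Real.exp (2 * η)) * selWeight x' p) *
        (ENNReal.ofReal (Real.exp (2 * η)) * (∑' p, selWeight x' p)⁻¹) :=
        mul_le_mul' (selWeight_le h p) hZ
    _ = _ := by
      rw [show 4 * η = 2 * η + 2 * η by ring, Real.exp_add, ENNReal.ofReal_mul (Real.exp_nonneg _)]
      ring

theorem inv_one_sub_exp_neg_half_le : (1 - Real.exp (-(1 / 2 : ℝ)))⁻¹ ≤ 3 := by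
  have h : 3 / 2 ≤ Real.exp (1 / 2 : ℝ) := by
    have := Real.add_one_le_exp (1 / 2 : ℝ); linarith
  have h2 : Real.exp (-(1 / 2 : ℝ)) ≤ 2 / 3 := by
    rw [Real.exp_neg, inv_le_comm₀ (Real.exp_pos _) (by norm_num)]
    linarith
  rw [inv_le_comm₀ (by linarith) (by norm_num)]
  linarith

theorem tsum_exp_neg_abs_sub_le {x : ℝ} (hx : 0 ≤ x) :
    ∑' j : ℕ, ENNReal.ofReal (Real.exp (-(|x - j| / 2))) ≤ 9 := by
  have hb := tsum_ofReal_exp_neg_mul_le (1 / 2) (by norm_num) inv_one_sub_exp_neg_half_le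
  have e3 : ENNReal.ofReal 3 = 3 := by simp
  rw [e3] at hb
  set a := ⌊x⌋₊ with ha
  have ha1 : (a : ℝ) ≤ x := Nat.floor_le hx
  have ha2 : x < a + 1 := Nat.lt_floor_add_one x
  rw [← ENNReal.summable.sum_add_tsum_nat_add' (k := a + 1)]
  have h1 : ∑ j ∈ Finset.range (a + 1), ENNReal.ofReal (Real.exp (-(|x - j| / 2))) ≤ 3 := by
    calc _ ≤ ∑ j ∈ Finset.range (a + 1), ENNReal.ofReal (Real.exp (-(1 / 2 * ((a + 1 - 1 - j : ℕ) : ℝ)))) := by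
          refine Finset.sum_le_sum fun j hj => ENNReal.ofReal_le_ofReal (Real.exp_le_exp.2 ?_)
          have hj' : j ≤ a := by simpa [Nat.lt_succ_iff] using hj
          have : ((a + 1 - 1 - j : ℕ) : ℝ) = a - j := by
            rw [Nat.add_sub_cancel, Nat.cast_sub hj']
          rw [this]
          have := le_abs_self (x - j)
          linarith
      _ = ∑ j ∈ Finset.range (a + 1), ENNReal.ofReal (Real.exp (-(1 / 2 * (j : ℝ)))) :=
          Finset.sum_range_reflect (fun j : ℕ => ENNReal.ofReal (Real.exp (-(1 / 2 * (j : ℝ))))) (a + 1)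
      _ ≤ _ := (ENNReal.sum_le_tsum _).trans hb
  have h2 : ∑' j : ℕ, ENNReal.ofReal (Real.exp (-(|x - ((j + (a + 1) : ℕ) : ℝ)| / 2))) ≤ 3 := by
    refine (ENNReal.tsum_le_tsum fun j => ENNReal.ofReal_le_ofReal (Real.exp_le_exp.2 ?_)).trans hb
    have := neg_abs_le (x - ((j + (a + 1) : ℕ) : ℝ))
    push_cast at this ⊢
    linarith
  exact (add_le_add h1 h2).trans (by norm_num)

/-- With `D = |x r - j|`, the coefficient 2 in the weight gives `2 * D + j ≥ x r + D`. The
normalizing sum is at least `exp (-(m + 2))`, because of the minimizer paired with `⌊m⌋₊`. For a bad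
pair, half of the excess `x r + D - m` exceeds `t / 2`, and the other half is at least `D / 2`,
which makes the sum over `j` converge. -/
theorem expMech_whp [Fintype R] [Nonempty R] {x : R → ℝ} (hx : ∀ r, 0 ≤ x r) (t : ℝ) :
    WHP (Fintype.card R * ENNReal.ofReal (9 * Real.exp (2 - t / 2))) (expMech x)
      (fun p => ∀ r', x p.1 + |x p.1 - p.2| ≤ x r' + t) := by
  obtain ⟨r₀, hr₀⟩ := Finite.exists_min x
  set m := x r₀ with hm
  have hm0 : 0 ≤ m := hx r₀
  have hZ : ENNReal.ofReal (Real.exp (-(m + 2))) ≤ ∑' p, selWeight x p := by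
    refine le_trans ?_ (ENNReal.le_tsum (r₀, ⌊m⌋₊))
    refine ENNReal.ofReal_le_ofReal (Real.exp_le_exp.2 ?_)
    have h1 := Nat.floor_le hm0
    have h2 := Nat.lt_floor_add_one m
    simp only [← hm]
    rw [abs_of_nonneg (by linarith)]
    linarith
  have hZ' : (∑' p, selWeight x p)⁻¹ ≤ ENNReal.ofReal (Real.exp (m + 2)) := by
    rw [← ENNReal.inv_le_inv, inv_inv, ← ENNReal.ofReal_inv_of_pos (Real.exp_pos _),
      ← Real.exp_neg]
    exact hZ
  unfold WHP
  rw [PMF.toOuterMeasure_apply]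
  calc _ ≤ ∑' p : R × ℕ, ENNReal.ofReal (Real.exp (2 - t / 2)) *
        ENNReal.ofReal (Real.exp (-(|x p.1 - p.2| / 2))) := by
        refine ENNReal.tsum_le_tsum fun p => ?_
        by_cases hp : ∀ r', x p.1 + |x p.1 - p.2| ≤ x r' + t
        · rw [Set.indicator_of_notMem (fun h : ¬ _ => h hp)]; exact zero_le
        · rw [Set.indicator_of_mem (show ¬ _ from hp)]
          push Not at hp
          obtain ⟨r', hr'⟩ := hp
          have h0 := hr₀ r'
          have h1 := hr₀ p.1
          have h2 : x p.1 - p.2 ≤ |x p.1 - p.2| := le_abs_self _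
          unfold expMech
          rw [PMF.normalize_apply]
          refine (mul_le_mul_right hZ' _).trans ?_
          unfold selWeight
          rw [← ENNReal.ofReal_mul (Real.exp_nonneg _), ← ENNReal.ofReal_mul (Real.exp_nonneg _),
            ← Real.exp_add, ← Real.exp_add]
          refine ENNReal.ofReal_le_ofReal (Real.exp_le_exp.2 ?_)
          linarith
    _ = ENNReal.ofReal (Real.exp (2 - t / 2)) *
        ∑ r : R, ∑' j : ℕ, ENNReal.ofReal (Real.exp (-(|x r - j| / 2))) := by
        rw [ENNReal.tsum_mul_left, ENNReal.tsum_prod', tsum_fintype]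
    _ ≤ ENNReal.ofReal (Real.exp (2 - t / 2)) * ∑ _r : R, 9 := by
        gcongr with r _
        exact tsum_exp_neg_abs_sub_le (hx r)
    _ = _ := by
        rw [ENNReal.ofReal_mul (by norm_num)]
        simp
        ring

/-- A noisy rounding of a nonnegative real number. -/
noncomputable def noisyRound (y : ℝ) : PMF ℕ :=
  (expMech (fun _ : Unit => y)).map Prod.snd

theorem noisyRound_pureClose (y y' : ℝ) :
    PureClose (4 * |y - y'|) (noisyRound y) (noisyRound y') :=
  (expMech_pureClose fun _ => le_rfl).map _

theorem noisyRound_whp {y : ℝ} (hy : 0 ≤ y) (t : ℝ) :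
    WHP (ENNReal.ofReal (9 * Real.exp (2 - t / 2))) (noisyRound y) (fun j => |y - j| ≤ t) := by
  refine WHP.map (WHP.mono (expMech_whp (fun _ => hy) t) (by simp) fun p hp => ?_)
  have := hp ()
  linarith

open Classical in
/-- Independent noisy roundings of the coordinates listed in `l`. -/
noncomputable def noisyVector {E : Type*} (y : E → ℝ) : List E → PMF (E → ℕ)
  | [] => PMF.pure 0
  | e :: l => (noisyRound (y e)).bind fun j => (noisyVector y l).map fun N => Function.update N e j

theorem noisyVector_pureClose {E : Type*} (y y' : E → ℝ) (l : List E) :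
    PureClose ((l.map fun e => 4 * |y e - y' e|).sum) (noisyVector y l) (noisyVector y' l) := by
  induction l with
  | nil => simpa [noisyVector] using PureClose.refl _
  | cons e l ih =>
    rw [List.map_cons, List.sum_cons]
    exact (noisyRound_pureClose _ _).bind fun j => ih.map _

theorem noisyVector_whp {E : Type*} {y : E → ℝ} (hy : ∀ e, 0 ≤ y e) (t : ℝ)
    (l : List E) : WHP (l.length * ENNReal.ofReal (9 * Real.exp (2 - t / 2))) (noisyVector y l)
      (fun N => ∀ e ∈ l, |y e - N e| ≤ t) := by
  classical
  induction l with
  | nil => exact WHP.pure _ (by simp)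
  | cons e l ih =>
    refine WHP.mono ((noisyRound_whp (hy e) t).bind (f := fun j => (noisyVector y l).map
      fun N => Function.update N e j) fun j hj => WHP.map (WHP.mono ih le_rfl fun N hN => ?_))
      (le_of_eq ?_) fun _ h => h
    · intro e' he'
      by_cases h : e' = e
      · subst h; simpa using hj
      · rw [Function.update_of_ne h]
        exact hN e' (by simpa [h] using he')
    · push_cast [List.length_cons]; ring

end ExponentialMechanism

/-! ### Random hubs hit large sets -/

section HittingSets

theorem uniform_whp_hits {V : Type*} [Fintype V] [Nonempty V] [DecidableEq V] (s : ℕ)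
    (A : Finset V) :
    WHP (ENNReal.ofReal (Real.exp (-(A.card * s / Fintype.card V))))
      (PMF.uniformOfFintype (Fin s → V)) (fun f => ∃ i, f i ∈ A) := by
  classical
  unfold WHP
  have hset : {f : Fin s → V | ¬ ∃ i, f i ∈ A} = ↑(Fintype.piFinset fun _ : Fin s => Aᶜ) := by
    ext f; simp
  have hn : (0 : ℝ) < Fintype.card V := by exact_mod_cast Fintype.card_pos
  rw [hset, PMF.toOuterMeasure_uniformOfFintype_apply]
  simp only [Fintype.card_coe, Finset.coe_sort_coe, Fintype.card_piFinset_const, Finset.card_compl,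
    Fintype.card_fun, Fintype.card_fin]
  have hle : A.card ≤ Fintype.card V := Finset.card_le_univ A
  rw [← ENNReal.ofReal_natCast, ← ENNReal.ofReal_natCast, ← ENNReal.ofReal_div_of_pos (by positivity)]
  refine ENNReal.ofReal_le_ofReal ?_
  push_cast [Nat.cast_sub hle]
  rw [← div_pow]
  have h1 : ((Fintype.card V : ℝ) - A.card) / Fintype.card V ≤
      Real.exp (-(A.card / Fintype.card V)) := by
    have := Real.add_one_le_exp (-((A.card : ℝ) / Fintype.card V))
    rw [sub_div, div_self hn.ne']
    linarith
  calc _ ≤ Real.exp (-(A.card / Fintype.card V)) ^ s := by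
        refine pow_le_pow_left₀ (div_nonneg ?_ hn.le) h1 s
        have : (A.card : ℝ) ≤ Fintype.card V := by exact_mod_cast hle
        linarith
    _ = _ := by
        rw [← Real.exp_nat_mul]
        congr 1
        ring

end HittingSets

/-! ### Weighted distances, their sensitivity, and the ends of long paths -/

section WeightedWalks

variable {V : Type*} {G : SimpleGraph V}

theorem walkWeight_append (w : EdgeWeights G) {u v x : V} (p : G.Walk u v) (q : G.Walk v x) :
    walkWeight w (p.append q) = walkWeight w p + walkWeight w q := by
  induction p with
  | nil => simp [walkWeight]
  | cons h p ih => simp [walkWeight, ih, add_assoc]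

theorem walkWeight_reverse (w : EdgeWeights G) {u v : V} (p : G.Walk u v) :
    walkWeight w p.reverse = walkWeight w p := by
  induction p with
  | nil => simp [walkWeight]
  | cons h p ih =>
    rw [SimpleGraph.Walk.reverse_cons, walkWeight_append, ih]
    simp only [walkWeight, add_zero]
    rw [add_comm]
    congr 2
    exact Subtype.ext Sym2.eq_swap

open Classical in
/-- Edge weights extended by zero to all unordered pairs. -/
noncomputable def extendWeight (w : EdgeWeights G) (e : Sym2 V) : ℝ≥0 :=
  if h : e ∈ G.edgeSet then w ⟨e, h⟩ else 0

theorem extendWeight_coe (w : EdgeWeights G) (e : G.edgeSet) : extendWeight w e = w e := by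
  simp [extendWeight]

theorem walkWeight_eq_sum (w : EdgeWeights G) {u v : V} (p : G.Walk u v) :
    walkWeight w p = (p.edges.map (extendWeight w)).sum := by
  induction p with
  | nil => simp [walkWeight]
  | cons h p ih =>
    have : extendWeight w s(_, _) = w ⟨s(_, _), h⟩ := extendWeight_coe w ⟨_, h⟩
    simp [walkWeight, ih, this]

theorem walkWeight_bypass_le [DecidableEq V] (w : EdgeWeights G) {u v : V} (p : G.Walk u v) :
    walkWeight w p.bypass ≤ walkWeight w p := by
  rw [walkWeight_eq_sum, walkWeight_eq_sum]
  exact (p.edges_bypass_sublist_edges.map _).sum_le_sum fun _ _ => zero_le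

/-- A path uses each edge at most once, so no coordinate of `w - w'` is charged twice. -/
theorem walkWeight_le_add_of_isPath [Fintype G.edgeSet] (w w' : EdgeWeights G) {u v : V}
    {p : G.Walk u v} (hp : p.IsPath) :
    (walkWeight w p : ℝ) ≤ walkWeight w' p + ∑ e, |(w e : ℝ) - (w' e : ℝ)| := by
  classical
  have hsum : ∀ w : EdgeWeights G, (walkWeight w p : ℝ) =
      ∑ e ∈ p.edges.toFinset, (extendWeight w e : ℝ) := by
    intro w
    rw [walkWeight_eq_sum, ← List.sum_toFinset _ hp.isTrail.edges_nodup]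
    push_cast
    rfl
  have hE : ∑ e : G.edgeSet, |(w e : ℝ) - (w' e : ℝ)| =
      ∑ e ∈ G.edgeFinset, |(extendWeight w e : ℝ) - extendWeight w' e| := by
    refine Eq.trans ?_ (Finset.sum_subtype (F := ‹Fintype G.edgeSet›) G.edgeFinset
      (by simp) (fun e => |(extendWeight w e : ℝ) - extendWeight w' e|)).symm
    exact Finset.sum_congr rfl fun e _ => by rw [extendWeight_coe, extendWeight_coe]
  rw [hsum, hsum, hE]
  calc ∑ e ∈ p.edges.toFinset, (extendWeight w e : ℝ)
      ≤ ∑ e ∈ p.edges.toFinset, ((extendWeight w' e : ℝ) +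
        |(extendWeight w e : ℝ) - extendWeight w' e|) := by
        refine Finset.sum_le_sum fun e _ => ?_
        linarith [le_abs_self ((extendWeight w e : ℝ) - extendWeight w' e)]
    _ ≤ _ := by
        rw [Finset.sum_add_distrib]
        gcongr
        intro e he
        rw [List.mem_toFinset] at he
        exact SimpleGraph.mem_edgeFinset.2 (p.edges_subset_edgeSet he)

theorem walkWeight_mono {w w' : EdgeWeights G} (h : ∀ e, w e ≤ w' e) {u v : V} (p : G.Walk u v) :
    walkWeight w p ≤ walkWeight w' p := by
  induction p with
  | nil => simp [walkWeight]
  | cons h' p ih => exact add_le_add (h _) ih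

theorem walkWeight_le_add_length_mul {w w' : EdgeWeights G} {τ : ℝ≥0} (h : ∀ e, w' e ≤ w e + τ)
    {u v : V} (p : G.Walk u v) : walkWeight w' p ≤ walkWeight w p + p.length * τ := by
  induction p with
  | nil => simp [walkWeight]
  | cons h' p ih =>
    simp only [walkWeight, SimpleGraph.Walk.length_cons]
    refine (add_le_add (h _) ih).trans (le_of_eq ?_)
    push_cast
    ring

theorem walkWeight_le_length_mul {w : EdgeWeights G} {B : ℝ≥0} {u v : V} (p : G.Walk u v)
    (h : ∀ e (he : e ∈ p.edges), w ⟨e, p.edges_subset_edgeSet he⟩ ≤ B) :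
    walkWeight w p ≤ p.length * B := by
  induction p with
  | nil => simp [walkWeight]
  | cons h' p ih =>
    simp only [walkWeight, SimpleGraph.Walk.length_cons]
    refine (add_le_add (h _ (by simp)) (ih fun e he => h e (by simp [he]))).trans (le_of_eq ?_)
    push_cast
    ring

theorem wdist_le (w : EdgeWeights G) {u v : V} (p : G.Walk u v) : wdist w u v ≤ walkWeight w p :=
  iInf_le _ p

theorem wdist_self (w : EdgeWeights G) (u : V) : wdist w u u = 0 :=
  le_antisymm ((wdist_le w .nil).trans (by simp [walkWeight])) zero_le

theorem wdist_comm (w : EdgeWeights G) (u v : V) : wdist w u v = wdist w v u := by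
  have : ∀ u v : V, wdist w u v ≤ wdist w v u := fun u v => le_iInf fun p => by
    rw [← walkWeight_reverse]
    exact wdist_le w _
  exact le_antisymm (this u v) (this v u)

theorem wdist_triangle (w : EdgeWeights G) (u v x : V) :
    wdist w u x ≤ wdist w u v + wdist w v x := by
  refine ENNReal.le_iInf_add_iInf fun p q => (wdist_le w (p.append q)).trans ?_
  rw [walkWeight_append, ENNReal.coe_add]

theorem wdist_mono {w w' : EdgeWeights G} (h : ∀ e, w e ≤ w' e) (u v : V) :
    wdist w u v ≤ wdist w' u v :=
  iInf_mono fun p => by exact_mod_cast walkWeight_mono h p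

theorem wdist_eq_top {w : EdgeWeights G} {u v : V} (h : ¬ G.Reachable u v) : wdist w u v = ⊤ := by
  have : IsEmpty (G.Walk u v) := ⟨fun p => h ⟨p⟩⟩
  simp [wdist]

theorem wdist_ne_top {w : EdgeWeights G} {u v : V} (h : G.Reachable u v) : wdist w u v ≠ ⊤ := by
  obtain ⟨p⟩ := h
  exact ((wdist_le w p).trans_lt ENNReal.coe_lt_top).ne

theorem exists_isPath_walkWeight_eq [Finite V] (w : EdgeWeights G) {u v : V}
    (h : G.Reachable u v) : ∃ p : G.Walk u v, p.IsPath ∧ wdist w u v = walkWeight w p := by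
  classical
  have := Fintype.ofFinite V
  obtain ⟨p₀⟩ := h
  have : Nonempty (G.Path u v) := ⟨p₀.toPath⟩
  obtain ⟨p, hp⟩ := Finite.exists_min (fun p : G.Path u v => walkWeight w (p : G.Walk u v))
  refine ⟨p, p.2, le_antisymm (wdist_le w _) (le_iInf fun q => ?_)⟩
  exact_mod_cast (hp q.toPath).trans (walkWeight_bypass_le w q)

theorem abs_wdist_sub_le [Finite V] [Fintype G.edgeSet] {w w' : EdgeWeights G} (h : Neighbors w w')
    (u v : V) : |(wdist w u v).toReal - (wdist w' u v).toReal| ≤ 1 := by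
  by_cases hr : G.Reachable u v
  · have key : ∀ w w' : EdgeWeights G, Neighbors w w' →
        (wdist w u v).toReal ≤ (wdist w' u v).toReal + 1 := by
      intro w w' h
      obtain ⟨p, hp, hpw⟩ := exists_isPath_walkWeight_eq w' hr
      rw [hpw, ENNReal.coe_toReal]
      have h1 := ENNReal.toReal_mono ENNReal.coe_ne_top (wdist_le w p)
      rw [ENNReal.coe_toReal] at h1
      have h2 := walkWeight_le_add_of_isPath w w' hp
      unfold Neighbors at h
      linarith
    have h' : Neighbors w' w := by
      unfold Neighbors at *
      simpa only [abs_sub_comm] using h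
    rw [abs_le]
    constructor <;> linarith [key w w' h, key w' w h']
  -- Reachability depends only on the public graph, so both distances are infinite and both `toReal`
  -- values are 0.
  · simp [wdist_eq_top hr]

theorem exists_append_eq {u v : V} (p : G.Walk u v) {i : ℕ} (hi : i ≤ p.length) :
    ∃ (x : V) (q : G.Walk u x) (r : G.Walk x v), x = p.getVert i ∧ p = q.append r ∧
      q.length = i := by
  induction p generalizing i with
  | nil =>
    have : i = 0 := by simpa using hi
    subst this
    exact ⟨_, .nil, .nil, rfl, rfl, rfl⟩
  | cons h p ih =>
    rcases i with _ | i
    · exact ⟨_, .nil, .cons h p, by simp, rfl, rfl⟩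
    · obtain ⟨x, q, r, hx, hp, hq⟩ := ih (i := i) (by simpa using hi)
      exact ⟨x, .cons h q, r, by simpa using hx, by simp [hp], by simp [hq]⟩

/-- A long path has an initial and a final segment such that every choice of vertices on these
segments splits off short subwalks at both ends. -/
theorem exists_segments [DecidableEq V] {u v : V} {p : G.Walk u v} (hp : p.IsPath) {h : ℕ}
    (hl : 2 * h < p.length) :
    ∃ A B : Finset V, A.card = h + 1 ∧ B.card = h + 1 ∧ ∀ a ∈ A, ∀ b ∈ B,
      ∃ (p₁ : G.Walk u a) (p₂ : G.Walk a b) (p₃ : G.Walk b v),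
        p₁.length ≤ h ∧ p₃.length ≤ h ∧ p = (p₁.append p₂).append p₃ := by
  have hinj := hp.getVert_injOn
  have hlen : ∀ {i : ℕ}, i ∈ Finset.range (h + 1) → i ≤ h := fun hi =>
    Nat.lt_succ_iff.1 (Finset.mem_range.1 hi)
  refine ⟨(Finset.range (h + 1)).image p.getVert,
    (Finset.range (h + 1)).image fun i => p.getVert (p.length - i), ?_, ?_, ?_⟩
  · rw [Finset.card_image_of_injOn, Finset.card_range]
    intro i hi j hj hij
    have hi := hlen hi
    have hj := hlen hj
    exact hinj (show i ≤ _ by omega) (show j ≤ _ by omega) hij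
  · rw [Finset.card_image_of_injOn, Finset.card_range]
    intro i hi j hj hij
    have hi := hlen hi
    have hj := hlen hj
    have := hinj (show p.length - i ≤ _ by omega) (show p.length - j ≤ _ by omega) hij
    omega
  · intro a ha b hb
    obtain ⟨i, hi, rfl⟩ := Finset.mem_image.1 ha
    obtain ⟨j, hj, rfl⟩ := Finset.mem_image.1 hb
    have hi := hlen hi
    have hj := hlen hj
    obtain ⟨y, q, r, hy, hpq, hq⟩ := exists_append_eq p (i := p.length - j) (by omega)
    obtain ⟨x, q₁, q₂, hx, hqq, hq₁⟩ := exists_append_eq q (i := i) (by omega)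
    have hx' : x = p.getVert i := by
      rw [hx, hpq, SimpleGraph.Walk.getVert_append]
      rw [if_pos (by omega)]
    subst hx'
    subst hy
    refine ⟨q₁, q₂, r, by omega, ?_, by rw [← hqq, ← hpq]⟩
    have := congrArg SimpleGraph.Walk.length hpq
    rw [SimpleGraph.Walk.length_append] at this
    omega

end WeightedWalks

/-! ### The Moore bound for graphs of large girth -/

section LargeGirth

variable {V : Type*}

/-- Every edge can only be bypassed by walks of length at least `2 * k`, i.e. the girth of `H`
exceeds `2 * k`. -/
def NoShortcut (k : ℕ) (H : SimpleGraph V) : Prop :=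
  ∀ a b, H.Adj a b → ∀ p : (H.deleteEdges {s(a, b)}).Walk a b, 2 * k ≤ p.length

theorem NoShortcut.mono {k : ℕ} {K H : SimpleGraph V} (hKH : K ≤ H) (h : NoShortcut k H) :
    NoShortcut k K := by
  intro a b hab p
  have := h a b (hKH hab) (p.mapLe (SimpleGraph.deleteEdges_mono hKH))
  simpa using this

theorem NoShortcut.bot (k : ℕ) : NoShortcut k (⊥ : SimpleGraph V) := by
  intro a b hab
  exact absurd hab (by simp)

/-- A walk can be shortened until it crosses the new edge at most once; the last two alternatives
are the two directions of crossing. -/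
theorem exists_walk_of_walk_sup_edge {K : SimpleGraph V} {x y a b : V}
    (p : (K ⊔ SimpleGraph.edge x y).Walk a b) :
    (∃ q : K.Walk a b, q.length ≤ p.length) ∨
    (∃ (q₁ : K.Walk a x) (q₂ : K.Walk y b), q₁.length + q₂.length + 1 ≤ p.length) ∨
    (∃ (q₁ : K.Walk a y) (q₂ : K.Walk x b), q₁.length + q₂.length + 1 ≤ p.length) := by
  induction p with
  | nil => exact Or.inl ⟨.nil, le_rfl⟩
  | @cons a c b h p ih =>
    rw [SimpleGraph.Walk.length_cons]
    rcases h with h | h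
    · rcases ih with ⟨q, hq⟩ | ⟨q₁, q₂, hq⟩ | ⟨q₁, q₂, hq⟩
      · exact Or.inl ⟨.cons h q, by simpa using hq⟩
      · exact Or.inr (Or.inl ⟨.cons h q₁, q₂, by rw [SimpleGraph.Walk.length_cons]; omega⟩)
      · exact Or.inr (Or.inr ⟨.cons h q₁, q₂, by rw [SimpleGraph.Walk.length_cons]; omega⟩)
    · rw [SimpleGraph.edge_adj] at h
      rcases h with ⟨⟨rfl, rfl⟩ | ⟨rfl, rfl⟩, -⟩
      · rcases ih with ⟨q, hq⟩ | ⟨q₁, q₂, hq⟩ | ⟨q₁, q₂, hq⟩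
        · exact Or.inr (Or.inl ⟨.nil, q, by simpa using hq⟩)
        · exact Or.inr (Or.inl ⟨.nil, q₂, by simp; omega⟩)
        · exact Or.inl ⟨q₂, by omega⟩
      · rcases ih with ⟨q, hq⟩ | ⟨q₁, q₂, hq⟩ | ⟨q₁, q₂, hq⟩
        · exact Or.inr (Or.inr ⟨.nil, q, by simpa using hq⟩)
        · exact Or.inl ⟨q₂, by omega⟩
        · exact Or.inr (Or.inr ⟨.nil, q₂, by simp; omega⟩)

/-- If a detour around an old edge `ab` crosses the new edge, exchanging the new edge for `ab`
yields an `x`-`y` walk in `H` that is no longer than the detour. -/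
theorem NoShortcut.sup_edge {k : ℕ} {H : SimpleGraph V} (h : NoShortcut k H) {x y : V}
    (hxy : ∀ q : H.Walk x y, 2 * k ≤ q.length) : NoShortcut k (H ⊔ SimpleGraph.edge x y) := by
  intro a b hab p
  by_cases hs : s(x, y) = s(a, b)
  · have hle : (H ⊔ SimpleGraph.edge x y).deleteEdges {s(a, b)} ≤ H := by
      intro c d hcd
      rw [SimpleGraph.deleteEdges_adj, SimpleGraph.sup_adj, SimpleGraph.adj_edge] at hcd
      rcases hcd with ⟨h1 | h1, h2⟩
      · exact h1
      · exact absurd (by rw [← h1.1, hs]; rfl) h2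
    rcases Sym2.eq_iff.1 hs with ⟨rfl, rfl⟩ | ⟨rfl, rfl⟩
    · simpa using hxy (p.mapLe hle)
    · simpa using hxy (p.mapLe hle).reverse
  · have hab' : H.Adj a b := by
      rcases hab with h1 | h1
      · exact h1
      · exact absurd ((SimpleGraph.adj_edge _ _).1 h1).1 hs
    have hle : (H ⊔ SimpleGraph.edge x y).deleteEdges {s(a, b)} ≤
        H.deleteEdges {s(a, b)} ⊔ SimpleGraph.edge x y := by
      intro c d hcd
      rw [SimpleGraph.deleteEdges_adj, SimpleGraph.sup_adj] at hcd
      rcases hcd with ⟨h1 | h1, h2⟩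
      · exact Or.inl (SimpleGraph.deleteEdges_adj.2 ⟨h1, h2⟩)
      · exact Or.inr h1
    have hH : H.deleteEdges {s(a, b)} ≤ H := SimpleGraph.deleteEdges_le _
    have hlen : (p.mapLe hle).length = p.length := by simp
    rcases exists_walk_of_walk_sup_edge (p.mapLe hle) with ⟨q, hq⟩ | ⟨q₁, q₂, hq⟩ | ⟨q₁, q₂, hq⟩
    · have := h a b hab' q
      omega
    · have := hxy ((q₁.mapLe hH).reverse.append (.cons hab' (q₂.mapLe hH).reverse))
      simp at this
      omega
    · have := hxy ((q₂.mapLe hH).append (.cons hab'.symm (q₁.mapLe hH)))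
      simp at this
      omega

/-- On a shortest walk to `x ≠ u`, a visit to `u` would give `u` distance less than `i`. -/
theorem exists_walk_notMem_support {K : SimpleGraph V} {v u x : V} {i : ℕ}
    (hu : (i : ℕ∞) ≤ K.edist v u) (hx : K.edist v x ≤ i) (hxu : x ≠ u) :
    ∃ p : K.Walk v x, p.length ≤ i ∧ u ∉ p.support := by
  classical
  obtain ⟨p, hp⟩ := K.exists_walk_of_edist_ne_top (ne_top_of_le_ne_top (ENat.natCast_ne_top i) hx)
  rw [← hp] at hx
  have hx' : p.length ≤ i := by exact_mod_cast hx
  refine ⟨p, hx', fun hmem => ?_⟩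
  have h1 := SimpleGraph.Walk.length_takeUntil_lt_length hmem hxu.symm
  have h2 : (i : ℕ∞) ≤ (p.takeUntil u hmem).length := hu.trans (SimpleGraph.edist_le _)
  have h3 : i ≤ (p.takeUntil u hmem).length := by exact_mod_cast h2
  omega

/-- Uniqueness of parents in the breadth-first tree: for `x ≠ y`, the walk from `u` through `x` and
`v` to `y` would bypass the edge `uy` with at most `2 * i + 1 < 2 * k` edges. -/
theorem NoShortcut.eq_of_adj {k : ℕ} {K : SimpleGraph V} (h : NoShortcut k K) {v u x y : V} {i : ℕ}
    (hi : i < k) (hu : (i : ℕ∞) ≤ K.edist v u) (hux : K.Adj u x) (huy : K.Adj u y)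
    (hx : K.edist v x ≤ i) (hy : K.edist v y ≤ i) : x = y := by
  by_contra hne
  obtain ⟨p, hp, hpu⟩ := exists_walk_notMem_support hu hx hux.ne'
  obtain ⟨q, hq, hqu⟩ := exists_walk_notMem_support hu hy huy.ne'
  have hux' : (K.deleteEdges {s(u, y)}).Adj u x := by
    rw [SimpleGraph.deleteEdges_adj]
    refine ⟨hux, fun hmem => hne ?_⟩
    have : s(u, x) = s(u, y) := hmem
    exact Sym2.congr_right.1 this
  have hpe : ∀ e ∈ p.edges, e ∉ ({s(u, y)} : Set (Sym2 V)) := by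
    rintro e he rfl
    exact hpu (p.fst_mem_support_of_mem_edges he)
  have hqe : ∀ e ∈ q.edges, e ∉ ({s(u, y)} : Set (Sym2 V)) := by
    rintro e he rfl
    exact hqu (q.fst_mem_support_of_mem_edges he)
  have := h u y huy (.cons hux' ((p.toDeleteEdges _ hpe).reverse.append (q.toDeleteEdges _ hqe)))
  simp [SimpleGraph.Walk.toDeleteEdges] at this
  omega

-- Double counting of the edges between consecutive spheres. By `NoShortcut.eq_of_adj` a vertex at
-- distance `i` has at most one neighbor that is not farther, hence at least `d` in the next sphere,
-- and a vertex of the next sphere has at most one neighbor in the sphere before it.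
open Classical in
theorem NoShortcut.pow_le_card_sphere [Fintype V] {k d : ℕ} {K : SimpleGraph V} (h : NoShortcut k K) {v : V}
    (hdeg : ∀ u, K.Reachable v u → d + 1 ≤ (Finset.univ.filter (K.Adj u)).card) (i : ℕ)
    (hi : i ≤ k) : d ^ i ≤ (Finset.univ.filter fun u => K.edist v u = i).card := by
  induction i with
  | zero =>
    rw [pow_zero, Nat.one_le_iff_ne_zero, ← Nat.pos_iff_ne_zero, Finset.card_pos]
    exact ⟨v, by simp⟩
  | succ i ih =>
    have ih := ih (by omega)
    set N := Finset.univ.filter fun u => K.edist v u = i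
    set N' := Finset.univ.filter fun u => K.edist v u = (i + 1 : ℕ)
    have hcount : N.card * d ≤ N'.card * 1 := by
      refine Finset.card_mul_le_card_mul K.Adj (fun u hu => ?_) (fun z hz => ?_)
      · have hu : K.edist v u = i := (Finset.mem_filter.1 hu).2
        have hr : K.Reachable v u :=
          SimpleGraph.edist_ne_top_iff_reachable.1 (by rw [hu]; exact ENat.natCast_ne_top i)
        have hsub : (Finset.univ.filter (K.Adj u)) ⊆ Finset.bipartiteAbove K.Adj N' u ∪
            Finset.univ.filter (fun z => K.Adj u z ∧ K.edist v z ≤ i) := by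
          intro z hz
          have hz : K.Adj u z := (Finset.mem_filter.1 hz).2
          by_cases hle : K.edist v z ≤ i
          · exact Finset.mem_union_right _ (by simp [hz, hle])
          · refine Finset.mem_union_left _ ?_
            rw [Finset.mem_bipartiteAbove]
            refine ⟨Finset.mem_filter.2 ⟨Finset.mem_univ _, le_antisymm ?_ ?_⟩, hz⟩
            · have := K.edist_triangle (u := v) (v := u) (w := z)
              rw [hu, SimpleGraph.edist_eq_one_iff_adj.2 hz] at this
              exact_mod_cast this
            · push_cast
              exact Order.add_one_le_of_lt (not_le.1 hle)
        have hone : (Finset.univ.filter (fun z => K.Adj u z ∧ K.edist v z ≤ i)).card ≤ 1 := by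
          rw [Finset.card_le_one]
          intro a ha b hb
          have ha := (Finset.mem_filter.1 ha).2
          have hb := (Finset.mem_filter.1 hb).2
          exact h.eq_of_adj (by omega) hu.ge ha.1 hb.1 ha.2 hb.2
        have := (hdeg u hr).trans ((Finset.card_le_card hsub).trans (Finset.card_union_le _ _))
        omega
      · have hz : K.edist v z = (i + 1 : ℕ) := (Finset.mem_filter.1 hz).2
        rw [Finset.card_le_one]
        intro a ha b hb
        rw [Finset.mem_bipartiteBelow] at ha hb
        have ha1 := (Finset.mem_filter.1 ha.1).2
        have hb1 := (Finset.mem_filter.1 hb.1).2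
        refine h.eq_of_adj (v := v) (i := i) (by omega) ?_ ha.2.symm hb.2.symm ha1.le hb1.le
        rw [hz]
        exact_mod_cast Nat.le_succ i
    calc d ^ (i + 1) = d ^ i * d := pow_succ _ _
      _ ≤ N.card * d := Nat.mul_le_mul_right _ ih
      _ ≤ N'.card := by simpa using hcount

-- Otherwise the subgraph induced on `A` has all degrees at least `d + 1`; its sphere of radius `k`
-- around `v` has at least `d ^ k` vertices and misses `v`, which makes `A` too large.
open Classical in
theorem NoShortcut.exists_degree_le [Fintype V] {k d : ℕ} (hk : 1 ≤ k) {H : SimpleGraph V}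
    (h : NoShortcut k H) {A : Finset V} (hA : A.Nonempty) (hAd : A.card ≤ d ^ k) :
    ∃ a ∈ A, (A.filter (H.Adj a)).card ≤ d := by
  by_contra! hcon
  obtain ⟨v, hv⟩ := hA
  obtain ⟨K, hK⟩ : ∃ K : SimpleGraph V, ∀ x y, K.Adj x y ↔ H.Adj x y ∧ x ∈ A ∧ y ∈ A :=
    ⟨{ Adj := fun x y => H.Adj x y ∧ x ∈ A ∧ y ∈ A
       symm := ⟨fun x y hxy => ⟨hxy.1.symm, hxy.2.2, hxy.2.1⟩⟩
       loopless := ⟨fun x hx => hx.1.ne rfl⟩ }, fun _ _ => Iff.rfl⟩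
  have hKH : K ≤ H := fun x y hxy => ((hK x y).1 hxy).1
  have hreach : ∀ u, K.Reachable v u → u ∈ A := by
    rintro u ⟨p⟩
    induction p with
    | nil => exact hv
    | cons hadj p ih => exact ih ((hK _ _).1 hadj).2.2
  have hsph := (h.mono hKH).pow_le_card_sphere (v := v) (d := d) (fun u hu => by
    have hu := hreach u hu
    refine (Nat.succ_le_of_lt (hcon u hu)).trans (Finset.card_le_card fun z hz => ?_)
    have hz := Finset.mem_filter.1 hz
    exact Finset.mem_filter.2 ⟨Finset.mem_univ _, (hK _ _).2 ⟨hz.2, hu, hz.1⟩⟩) k le_rfl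
  have hsub : (Finset.univ.filter fun u => K.edist v u = k) ⊆ A.erase v := by
    intro u hu
    have hu : K.edist v u = k := (Finset.mem_filter.1 hu).2
    refine Finset.mem_erase.2 ⟨?_, hreach u
      (SimpleGraph.edist_ne_top_iff_reachable.1 (by rw [hu]; exact ENat.natCast_ne_top k))⟩
    rintro rfl
    rw [SimpleGraph.edist_self] at hu
    have : 0 = k := by exact_mod_cast hu
    omega
  have := Finset.card_le_card hsub
  rw [Finset.card_erase_of_mem hv] at this
  have := Finset.card_pos.2 ⟨v, hv⟩
  omega

open Classical in
/-- The number of (ordered) adjacent pairs in `A`. -/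
noncomputable def adjCount (H : SimpleGraph V) (A : Finset V) : ℕ :=
  ((A ×ˢ A).filter fun p => H.Adj p.1 p.2).card

/-- Vertices of degree at most `d` are peeled off one at a time; each accounts for at most `2 * d`
ordered pairs. -/
theorem NoShortcut.adjCount_le [Fintype V] {k d : ℕ} (hk : 1 ≤ k) {H : SimpleGraph V}
    (h : NoShortcut k H) (A : Finset V) (hAd : A.card ≤ d ^ k) :
    adjCount H A ≤ 2 * d * A.card := by
  classical
  induction hm : A.card generalizing A with
  | zero =>
    rw [Finset.card_eq_zero] at hm
    simp [hm, adjCount]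
  | succ m ih =>
    obtain ⟨a, ha, hdeg⟩ := h.exists_degree_le hk (Finset.card_pos.1 (by omega)) hAd
    have hcard : (A.erase a).card = m := by rw [Finset.card_erase_of_mem ha]; omega
    have ih := ih (A.erase a) (by omega) hcard
    have hsub : ((A ×ˢ A).filter fun p => H.Adj p.1 p.2) ⊆
        (((A.erase a) ×ˢ (A.erase a)).filter fun p => H.Adj p.1 p.2) ∪
        ((A.filter (H.Adj a)).image fun z => (a, z)) ∪
        ((A.filter (H.Adj a)).image fun z => (z, a)) := by
      rintro ⟨x, y⟩ hxy
      simp only [Finset.mem_filter, Finset.mem_product] at hxy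
      obtain ⟨⟨hx, hy⟩, hadj⟩ := hxy
      simp only [Finset.mem_union, Finset.mem_filter, Finset.mem_product, Finset.mem_erase,
        Finset.mem_image, Prod.mk.injEq]
      by_cases hxa : x = a
      · subst hxa
        exact Or.inl (Or.inr ⟨y, ⟨hy, hadj⟩, rfl, rfl⟩)
      · by_cases hya : y = a
        · subst hya
          exact Or.inr ⟨x, ⟨hx, hadj.symm⟩, rfl, rfl⟩
        · exact Or.inl (Or.inl ⟨⟨⟨hxa, hx⟩, ⟨hya, hy⟩⟩, hadj⟩)
    have h1 := (Finset.card_le_card hsub).trans ((Finset.card_union_le _ _).trans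
      (add_le_add_left (Finset.card_union_le _ _) _))
    have h2 : ((A.filter (H.Adj a)).image fun z => (a, z)).card ≤ d :=
      Finset.card_image_le.trans hdeg
    have h3 : ((A.filter (H.Adj a)).image fun z => (z, a)).card ≤ d :=
      Finset.card_image_le.trans hdeg
    unfold adjCount at *
    have h4 : 2 * d * (m + 1) = 2 * d * m + d + d := by ring
    omega

theorem adjCount_add_two_le {H : SimpleGraph V} {A : Finset V} {x y : V} (hx : x ∈ A) (hy : y ∈ A)
    (hne : x ≠ y) (hxy : ¬ H.Adj x y) :
    adjCount H A + 2 ≤ adjCount (H ⊔ SimpleGraph.edge x y) A := by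
  classical
  unfold adjCount
  have hpair : ({(x, y), (y, x)} : Finset (V × V)).card = 2 :=
    Finset.card_pair (by simp [hne])
  rw [← hpair, ← Finset.card_union_of_disjoint]
  · refine Finset.card_le_card fun p hp => ?_
    simp only [Finset.mem_union, Finset.mem_filter, Finset.mem_product, Finset.mem_insert,
      Finset.mem_singleton, SimpleGraph.sup_adj, SimpleGraph.edge_adj] at hp ⊢
    rcases hp with hp | rfl | rfl
    · exact ⟨hp.1, Or.inl hp.2⟩
    · simp [hx, hy, hne]
    · simp [hx, hy, hne.symm]
  · rw [Finset.disjoint_left]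
    intro p hp hp'
    simp only [Finset.mem_filter, Finset.mem_insert, Finset.mem_singleton] at hp hp'
    rcases hp' with rfl | rfl
    · exact hxy hp.2
    · exact hxy hp.2.symm

end LargeGirth

/-! ### The private greedy spanner and its invariant -/

section GreedySpanner

variable {V : Type*}

/-- A pair of hubs that are connected in `G` but not by fewer than `2 * k` edges of `H`. -/
abbrev Candidate (G : SimpleGraph V) (k : ℕ) (S : Finset V) (H : SimpleGraph V) : Type _ :=
  {p : V × V // p.1 ∈ S ∧ p.2 ∈ S ∧ G.Reachable p.1 p.2 ∧ ∀ q : H.Walk p.1 p.2, 2 * k ≤ q.length}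

noncomputable instance [Fintype V] (G : SimpleGraph V) (k : ℕ) (S : Finset V) (H : SimpleGraph V) :
    Fintype (Candidate G k S H) :=
  Fintype.ofFinite _

/-- The state of the greedy spanner: a graph on the vertices and approximate edge lengths. -/
abbrev SpannerState (V : Type*) : Type _ := SimpleGraph V × (Sym2 V → ℕ)

open Classical in
/-- Add an edge with the given length. -/
noncomputable def SpannerState.add (st : SpannerState V) (p : V × V) (j : ℕ) : SpannerState V :=
  (st.1 ⊔ SimpleGraph.edge p.1 p.2, Function.update st.2 s(p.1, p.2) j)

open Classical in
/-- The private greedy spanner: repeatedly select an approximately closest pair of hubs that the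
current graph does not yet connect by few edges, and add it with its approximate distance. -/
noncomputable def greedySpanner [Fintype V] (G : SimpleGraph V) (k : ℕ) (S : Finset V) (X : V → V → ℝ) :
    ℕ → SpannerState V → PMF (SpannerState V)
  | 0, st => PMF.pure st
  | T + 1, st =>
    if _h : Nonempty (Candidate G k S st.1) then
      (expMech (fun c : Candidate G k S st.1 => X c.1.1 c.1.2)).bind fun r =>
        greedySpanner G k S X T (st.add r.1.1 r.2)
    else PMF.pure st

/-- The candidates of each step depend only on the state already released, so both runs choose from
the same set and adaptive composition applies. -/
theorem greedySpanner_renyiClose [Fintype V] {G : SimpleGraph V} {k : ℕ} {S : Finset V} {X X' : V → V → ℝ}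
    {η a q : ℝ} (hη : 0 < η) (haq : a.HolderConjugate q) (h : ∀ x y, |X x y - X' x y| ≤ η) (T : ℕ)
    (st : SpannerState V) :
    RenyiClose q (ENNReal.ofReal (Real.exp (T * (a * (Real.exp (4 * η) - 1) ^ 2 / 2))))
      (greedySpanner G k S X T st) (greedySpanner G k S X' T st) := by
  have ha := haq.pos
  induction T generalizing st with
  | zero => simpa [greedySpanner] using RenyiClose.pure haq.symm.pos st
  | succ T ih =>
    unfold greedySpanner
    split_ifs with hc
    · refine RenyiClose.mono (RenyiClose.bind haq.symm.pos (PureClose.renyiClose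
        (by positivity : 0 < 4 * η) haq (expMech_pureClose fun _ => h _ _)
        (expMech_pureClose fun _ => by rw [abs_sub_comm]; exact h _ _)) fun r => ih _)
        (le_of_eq ?_)
      rw [← ENNReal.ofReal_mul (Real.exp_nonneg _), ← Real.exp_add]
      push_cast
      congr 2
      ring
    · refine (RenyiClose.pure haq.symm.pos st).mono ?_
      rw [ENNReal.one_le_ofReal, Real.one_le_exp_iff]
      positivity

/-- The invariant of the greedy spanner after `m` steps, when all errors are at most `t`. -/
structure GreedyInv (G : SimpleGraph V) (k : ℕ) (S : Finset V) (X : V → V → ℝ) (t : ℝ) (m : ℕ)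
    (st : SpannerState V) : Prop where
  noShortcut : NoShortcut k st.1
  reachable : ∀ x y, st.1.Adj x y → G.Reachable x y
  le_val : ∀ x y, st.1.Adj x y → X x y ≤ st.2 s(x, y) + t
  -- The second alternative describes pairs that were candidates at every step so far: each selected
  -- edge competed against them and was nearly no longer.
  cover : ∀ x ∈ S, ∀ y ∈ S, G.Reachable x y →
    (∃ p : st.1.Walk x y, p.length < 2 * k ∧ ∀ e ∈ p.edges, (st.2 e : ℝ) ≤ X x y + t) ∨
      ∀ e ∈ st.1.edgeSet, (st.2 e : ℝ) ≤ X x y + t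
  count : 2 * m ≤ adjCount st.1 S ∨ IsEmpty (Candidate G k S st.1)

theorem GreedyInv.init (G : SimpleGraph V) (k : ℕ) (S : Finset V) (X : V → V → ℝ) (t : ℝ)
    (val : Sym2 V → ℕ) : GreedyInv G k S X t 0 (⊥, val) where
  noShortcut := NoShortcut.bot k
  reachable x y h := absurd h (by simp)
  le_val x y h := absurd h (by simp)
  cover x _ y _ _ := Or.inr fun e he => absurd he (by simp)
  count := Or.inl (Nat.zero_le _)

theorem GreedyInv.cover_of_walk {G : SimpleGraph V} {k : ℕ} {S : Finset V} {X : V → V → ℝ} {t : ℝ}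
    {m : ℕ} {st : SpannerState V} (h : GreedyInv G k S X t m st) {x y : V} (hx : x ∈ S)
    (hy : y ∈ S) (hxy : G.Reachable x y) (q : st.1.Walk x y) (hq : q.length < 2 * k) :
    ∃ p : st.1.Walk x y, p.length < 2 * k ∧ ∀ e ∈ p.edges, (st.2 e : ℝ) ≤ X x y + t := by
  rcases h.cover x hx y hy hxy with h' | h'
  · exact h'
  · exact ⟨q, hq, fun e he => h' e (q.edges_subset_edgeSet he)⟩

/-- A pair already joined by a short walk has its cover fixed using old edges only. Any other pair
was a candidate in this step, and near-minimality of the selection bounds the new value `j` by its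
distance plus `t`. -/
theorem GreedyInv.add {G : SimpleGraph V} {k : ℕ} (hk : 1 ≤ k) {S : Finset V} {X : V → V → ℝ}
    (hX : ∀ x y, X x y = X y x) {t : ℝ} {m : ℕ} {st : SpannerState V}
    (h : GreedyInv G k S X t m st) (c : Candidate G k S st.1) (j : ℕ)
    (hj : ∀ c' : Candidate G k S st.1, X c.1.1 c.1.2 + |X c.1.1 c.1.2 - j| ≤ X c'.1.1 c'.1.2 + t) :
    GreedyInv G k S X t (m + 1) (st.add c.1 j) := by
  classical
  obtain ⟨⟨a, b⟩, ha, hb, hab, hwalk⟩ := c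
  simp only at ha hb hab hwalk hj
  have hnadj : ¬ st.1.Adj a b := fun hadj => by
    have := hwalk (.cons hadj .nil)
    simp at this
    omega
  have hne : a ≠ b := by
    rintro rfl
    have := hwalk .nil
    simp at this
    omega
  have hval : ∀ e ∈ st.1.edgeSet, (st.add (a, b) j).2 e = st.2 e := by
    intro e he
    refine Function.update_of_ne ?_ _ _
    rintro rfl
    exact hnadj he
  have hvab : (st.add (a, b) j).2 s(a, b) = j := Function.update_self _ _ _
  have hle : st.1 ≤ (st.add (a, b) j).1 := le_sup_left
  have hedge : ∀ x y, (st.add (a, b) j).1.Adj x y → st.1.Adj x y ∨ s(x, y) = s(a, b) := by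
    rintro x y (h1 | h1)
    · exact Or.inl h1
    · exact Or.inr ((SimpleGraph.adj_edge _ _).1 h1).1.symm
  refine ⟨h.noShortcut.sup_edge hwalk, ?_, ?_, ?_, ?_⟩
  · intro x y hxy
    rcases hedge x y hxy with h1 | h1
    · exact h.reachable x y h1
    · rcases Sym2.eq_iff.1 h1 with ⟨rfl, rfl⟩ | ⟨rfl, rfl⟩
      · exact hab
      · exact hab.symm
  · intro x y hxy
    rcases hedge x y hxy with h1 | h1
    · rw [hval _ h1]
      exact h.le_val x y h1
    · have hjab := hj ⟨(a, b), ha, hb, hab, hwalk⟩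
      simp only at hjab
      have hXxy : X x y = X a b := by
        rcases Sym2.eq_iff.1 h1 with ⟨rfl, rfl⟩ | ⟨rfl, rfl⟩
        · rfl
        · exact hX _ _
      rw [h1, hvab, hXxy]
      linarith [le_abs_self (X a b - j)]
  · intro x hx y hy hxy
    have hold : (∃ p : st.1.Walk x y, p.length < 2 * k ∧ ∀ e ∈ p.edges,
        (st.2 e : ℝ) ≤ X x y + t) → ∃ p : (st.add (a, b) j).1.Walk x y, p.length < 2 * k ∧
          ∀ e ∈ p.edges, ((st.add (a, b) j).2 e : ℝ) ≤ X x y + t := by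
      rintro ⟨p, hp, hpe⟩
      refine ⟨p.mapLe hle, by simpa using hp, fun e he => ?_⟩
      rw [SimpleGraph.Walk.edges_mapLe_eq_edges] at he
      rw [hval e (p.edges_subset_edgeSet he)]
      exact hpe e he
    by_cases hw : ∃ q : st.1.Walk x y, q.length < 2 * k
    · obtain ⟨q, hq⟩ := hw
      exact Or.inl (hold (h.cover_of_walk hx hy hxy q hq))
    · push Not at hw
      rcases h.cover x hx y hy hxy with h' | h'
      · exact Or.inl (hold h')
      · refine Or.inr fun e he => ?_
        induction e using Sym2.ind with
        | _ u v =>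
          rcases hedge u v he with h1 | h1
          · rw [hval _ h1]
            exact h' _ h1
          · rw [h1, hvab]
            have := hj ⟨(x, y), hx, hy, hxy, hw⟩
            simp only at this
            linarith [neg_abs_le (X a b - j)]
  · rcases h.count with h1 | h1
    · left
      have : adjCount st.1 S + 2 ≤ adjCount (st.add (a, b) j).1 S :=
        adjCount_add_two_le ha hb hne hnadj
      change 2 * (m + 1) ≤ adjCount (st.add (a, b) j).1 S
      omega
    · exact (h1.false ⟨(a, b), ha, hb, hab, hwalk⟩).elim

/-- Union bound over the steps, each with at most `n²` candidates. A run that stops early has no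
candidates left, which is why `count` has a second alternative. -/
theorem greedySpanner_whp [Fintype V] {G : SimpleGraph V} {k : ℕ} (hk : 1 ≤ k) {S : Finset V}
    {X : V → V → ℝ} (hX0 : ∀ x y, 0 ≤ X x y) (hX : ∀ x y, X x y = X y x) (t : ℝ) (T m : ℕ)
    {st : SpannerState V} (h : GreedyInv G k S X t m st) :
    WHP (T * ((Fintype.card V ^ 2 : ℕ) * ENNReal.ofReal (9 * Real.exp (2 - t / 2))))
      (greedySpanner G k S X T st) (GreedyInv G k S X t (m + T)) := by
  induction T generalizing st m with
  | zero => exact WHP.pure _ h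
  | succ T ih =>
    unfold greedySpanner
    split_ifs with hc
    · have step : ∀ r : Candidate G k S st.1 × ℕ,
          (∀ c' : Candidate G k S st.1, X r.1.1.1 r.1.1.2 + |X r.1.1.1 r.1.1.2 - r.2| ≤ X c'.1.1 c'.1.2 + t) → _ :=
        fun r hr => ih (m + 1) (h.add hk hX r.1 r.2 hr)
      simp_rw [add_assoc, add_comm 1 T] at step
      refine WHP.mono ((expMech_whp (x := fun c : Candidate G k S st.1 => X c.1.1 c.1.2)
        (fun _ => hX0 _ _) t).bind fun r hr => step r hr) ?_ fun _ h' => h'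
      push_cast
      rw [add_comm (T : ℝ≥0∞) 1, add_mul, one_mul]
      gcongr
      have : Fintype.card (Candidate G k S st.1) ≤ Fintype.card V ^ 2 := by
        refine (Fintype.card_subtype_le _).trans ?_
        rw [Fintype.card_prod, sq]
      exact_mod_cast this
    · exact WHP.pure _ { h with count := Or.inr (not_nonempty_iff.1 hc) }

/-- With more than `d * S.card` steps, `m` distinct edges would violate the girth bound, so no
candidate is left. -/
theorem GreedyInv.exists_walk [Fintype V] {G : SimpleGraph V} {k : ℕ} (hk : 1 ≤ k) {S : Finset V}
    {X : V → V → ℝ} {t : ℝ} {m d : ℕ} {st : SpannerState V} (h : GreedyInv G k S X t m st)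
    (hd : S.card ≤ d ^ k) (hm : d * S.card < m) {x y : V} (hx : x ∈ S) (hy : y ∈ S)
    (hxy : G.Reachable x y) :
    ∃ p : st.1.Walk x y, p.length < 2 * k ∧ ∀ e ∈ p.edges, (st.2 e : ℝ) ≤ X x y + t := by
  have hempty : IsEmpty (Candidate G k S st.1) := by
    rcases h.count with h1 | h1
    · have := h.noShortcut.adjCount_le hk S hd
      have h2 : 2 * d * S.card = 2 * (d * S.card) := by ring
      omega
    · exact h1
  by_contra hcon
  refine hempty.false ⟨(x, y), hx, hy, hxy, fun q => ?_⟩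
  by_contra! hq
  exact hcon (h.cover_of_walk hx hy hxy q hq)

end GreedySpanner

/-! ### Distances in the spanner against true distances -/

section HubDistances

variable {V : Type*}

/-- Edge lengths of the spanner, rescaled and shifted so that they overestimate distances. -/
noncomputable def spannerWeight (ε₀ t : ℝ) (st : SpannerState V) : EdgeWeights st.1 :=
  fun e => Real.toNNReal ((st.2 e + t) / ε₀)

variable {G : SimpleGraph V} {k : ℕ} {S : Finset V} {w : EdgeWeights G} {ε₀ t : ℝ}
  {m : ℕ} {st : SpannerState V}

theorem GreedyInv.wdist_le_wdist (hε : 0 < ε₀)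
    (h : GreedyInv G k S (fun x y => ε₀ * (wdist w x y).toReal) t m st) (a b : V) :
    wdist w a b ≤ wdist (spannerWeight ε₀ t st) a b := by
  refine le_iInf fun p => ?_
  induction p with
  | nil => simp [wdist_self]
  | @cons a c b hac p ih =>
    refine (wdist_triangle w a c b).trans ?_
    simp only [walkWeight, ENNReal.coe_add]
    refine add_le_add ?_ ih
    have h1 := h.le_val a c hac
    rw [← ENNReal.ofReal_toReal (wdist_ne_top (w := w) (h.reachable a c hac))]
    refine ENNReal.ofReal_le_ofReal ?_
    rw [le_div_iff₀ hε]
    linarith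

/-- In `2 * t` one `t` is the selection error and the other is the upward shift built into
`spannerWeight`. -/
theorem GreedyInv.wdist_le_mul [Fintype V] (hε : 0 < ε₀) (ht : 0 ≤ t) (hk : 1 ≤ k)
    (h : GreedyInv G k S (fun x y => ε₀ * (wdist w x y).toReal) t m st) {d : ℕ}
    (hd : S.card ≤ d ^ k) (hm : d * S.card < m) {a b : V} (ha : a ∈ S) (hb : b ∈ S)
    (hab : G.Reachable a b) :
    wdist (spannerWeight ε₀ t st) a b ≤
      (2 * k - 1 : ℕ) * (wdist w a b + ENNReal.ofReal (2 * t / ε₀)) := by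
  obtain ⟨p, hp, hpe⟩ := h.exists_walk hk hd hm ha hb hab
  refine (wdist_le _ p).trans ?_
  have h1 : walkWeight (spannerWeight ε₀ t st) p ≤
      p.length * Real.toNNReal ((wdist w a b).toReal + 2 * t / ε₀) := by
    refine walkWeight_le_length_mul p fun e he => Real.toNNReal_le_toNNReal ?_
    have := hpe e he
    rw [div_le_iff₀ hε, add_mul, div_mul_cancel₀ _ hε.ne']
    linarith
  have h2 : (p.length : ℝ≥0∞) ≤ (2 * k - 1 : ℕ) := by
    exact_mod_cast (by omega : p.length ≤ 2 * k - 1)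
  calc (walkWeight (spannerWeight ε₀ t st) p : ℝ≥0∞)
      ≤ p.length * ENNReal.ofReal ((wdist w a b).toReal + 2 * t / ε₀) := by
        have := ENNReal.coe_le_coe.2 h1
        rwa [ENNReal.coe_mul, ENNReal.coe_natCast] at this
    _ ≤ (2 * k - 1 : ℕ) * ENNReal.ofReal ((wdist w a b).toReal + 2 * t / ε₀) := by gcongr
    _ = _ := by
        rw [ENNReal.ofReal_add ENNReal.toReal_nonneg (by positivity),
          ENNReal.ofReal_toReal (wdist_ne_top hab)]

end HubDistances

/-! ### Combining local and hub distances -/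

section Estimates

variable {V : Type*} {G : SimpleGraph V}

/-- Combine local distances (in the noisy graph) with estimated distances between hubs. -/
noncomputable def combineEstimate (w₁ : EdgeWeights G) (S : Finset V) (D : V → V → ℝ≥0∞) (u v : V) :
    ℝ≥0∞ :=
  min (wdist w₁ u v) (⨅ a ∈ S, ⨅ b ∈ S, wdist w₁ u a + D a b + wdist w₁ b v)

theorem wdist_le_combineEstimate {w w₁ : EdgeWeights G} (hw : ∀ e, w e ≤ w₁ e) (S : Finset V)
    {D : V → V → ℝ≥0∞} (hD : ∀ a b, wdist w a b ≤ D a b) (u v : V) :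
    wdist w u v ≤ combineEstimate w₁ S D u v := by
  refine le_min (wdist_mono hw u v) (le_iInf₂ fun a _ => le_iInf₂ fun b _ => ?_)
  refine (wdist_triangle w u b v).trans (add_le_add ?_ (wdist_mono hw b v))
  exact (wdist_triangle w u a b).trans (add_le_add (wdist_mono hw u a) (hD a b))

/-- Some shortest path from `u` to `v` either has at most `2 * h` edges, or has at most `h` edges
before its first and after its last vertex in `S`. -/
def HubSplit (w : EdgeWeights G) (h : ℕ) (S : Finset V) (u v : V) : Prop :=
  (∃ p : G.Walk u v, wdist w u v = walkWeight w p ∧ p.length ≤ 2 * h) ∨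
  ∃ a ∈ S, ∃ b ∈ S, ∃ (p₁ : G.Walk u a) (p₂ : G.Walk a b) (p₃ : G.Walk b v),
    p₁.length ≤ h ∧ p₃.length ≤ h ∧ wdist w u v = walkWeight w ((p₁.append p₂).append p₃)

/-- In either case of `HubSplit` at most `2 * h` edges are measured with the noisy weights; only the
middle piece is stretched, and `1 ≤ K` absorbs the others. -/
theorem combineEstimate_le {w w₁ : EdgeWeights G} {τ : ℝ≥0} (hw : ∀ e, w₁ e ≤ w e + τ)
    {S : Finset V} {D : V → V → ℝ≥0∞} {K : ℕ} (hK : 1 ≤ K) {σ : ℝ≥0∞}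
    (hD : ∀ a ∈ S, ∀ b ∈ S, G.Reachable a b → D a b ≤ K * (wdist w a b + σ)) {h : ℕ} {u v : V}
    (hs : HubSplit w h S u v) :
    combineEstimate w₁ S D u v ≤ K * wdist w u v + (2 * h * τ + K * σ) := by
  have hK' : (1 : ℝ≥0∞) ≤ K := by exact_mod_cast hK
  have hwalk : ∀ {x y : V} (p : G.Walk x y) {l : ℕ}, p.length ≤ l →
      wdist w₁ x y ≤ walkWeight w p + l * τ := by
    intro x y p l hl
    refine (wdist_le w₁ p).trans ?_
    have h1 : walkWeight w₁ p ≤ walkWeight w p + l * τ :=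
      (walkWeight_le_add_length_mul hw p).trans (by gcongr)
    exact_mod_cast h1
  rcases hs with ⟨p, hp, hl⟩ | ⟨a, ha, b, hb, p₁, p₂, p₃, hl₁, hl₃, hp⟩
  · refine (min_le_left _ _).trans ((hwalk p hl).trans ?_)
    rw [← hp]
    push_cast
    exact add_le_add (le_mul_of_one_le_left' hK') le_self_add
  · refine (min_le_right _ _).trans ((iInf₂_le_of_le a ha (iInf₂_le_of_le b hb le_rfl)).trans ?_)
    have h2 : D a b ≤ K * (walkWeight w p₂ + σ) :=
      (hD a ha b hb ⟨p₂⟩).trans (by gcongr; exact wdist_le w p₂)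
    rw [hp, walkWeight_append, walkWeight_append]
    push_cast
    calc _ ≤ (walkWeight w p₁ + h * τ) + K * (walkWeight w p₂ + σ) + (walkWeight w p₃ + h * τ) :=
          add_le_add (add_le_add (hwalk p₁ hl₁) h2) (hwalk p₃ hl₃)
      _ ≤ (K * walkWeight w p₁ + h * τ) + K * (walkWeight w p₂ + σ) +
          (K * walkWeight w p₃ + h * τ) := by
          gcongr
          · exact le_mul_of_one_le_left' hK'
          · exact le_mul_of_one_le_left' hK'
      _ = _ := by ring

theorem isAccurate_of_le {w : EdgeWeights G} {K : ℕ} {γ α : ℝ} (hγ : γ = K) (hα : 0 ≤ α)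
    {est : V → V → ℝ≥0∞} (h₁ : ∀ u v, wdist w u v ≤ est u v)
    (h₂ : ∀ u v, G.Reachable u v → est u v ≤ K * wdist w u v + ENNReal.ofReal α) (hK : 1 ≤ K) :
    IsAccurate w γ α (fun u v => (est u v : EReal)) := by
  intro u v
  constructor
  · refine le_trans ?_ (EReal.coe_ennreal_le_coe_ennreal_iff.2 (h₁ u v))
    refine EReal.sub_le_of_le_add ?_
    exact le_add_of_nonneg_right (by exact_mod_cast hα)
  · by_cases hr : G.Reachable u v
    · have := EReal.coe_ennreal_le_coe_ennreal_iff.2 (h₂ u v hr)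
      refine this.trans (le_of_eq ?_)
      rw [EReal.coe_ennreal_add, EReal.coe_ennreal_mul, EReal.coe_ennreal_ofReal, max_eq_left hα,
        hγ]
      congr 2
    · have hγ0 : 0 < γ := by rw [hγ]; exact_mod_cast hK
      rw [wdist_eq_top hr, EReal.coe_ennreal_top, EReal.coe_mul_top_of_pos hγ0,
        EReal.top_add_coe]
      exact le_top

end Estimates

/-! ### Composing pure with approximate privacy -/

section ApproximateCloseness

variable {X Y : Type*}

/-- The `(ε, δ)`-indistinguishability inequality between two distributions. -/
def ApproxClose (ε δ : ℝ) (P Q : PMF X) : Prop :=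
  ∀ S : Set X, P.toOuterMeasure S ≤
    ENNReal.ofReal (Real.exp ε) * Q.toOuterMeasure S + ENNReal.ofReal δ

theorem ApproxClose.bind {c ε δ : ℝ} {P Q : PMF X} {f g : X → PMF Y} (h : PureClose c P Q)
    (hf : ∀ x, ApproxClose ε δ (f x) (g x)) : ApproxClose (c + ε) δ (P.bind f) (Q.bind g) := by
  intro S
  rw [PMF.toOuterMeasure_bind_apply, PMF.toOuterMeasure_bind_apply]
  calc ∑' x, P x * (f x).toOuterMeasure S
      ≤ ∑' x, (ENNReal.ofReal (Real.exp (c + ε)) * (Q x * (g x).toOuterMeasure S) +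
          P x * ENNReal.ofReal δ) := by
        refine ENNReal.tsum_le_tsum fun x => ?_
        calc P x * (f x).toOuterMeasure S
            ≤ P x * (ENNReal.ofReal (Real.exp ε) * (g x).toOuterMeasure S + ENNReal.ofReal δ) :=
              mul_le_mul_right (hf x S) _
          _ = P x * (ENNReal.ofReal (Real.exp ε) * (g x).toOuterMeasure S) +
                P x * ENNReal.ofReal δ := mul_add _ _ _
          _ ≤ (ENNReal.ofReal (Real.exp c) * Q x) *
                (ENNReal.ofReal (Real.exp ε) * (g x).toOuterMeasure S) + P x * ENNReal.ofReal δ :=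
              add_le_add_left (mul_le_mul_left (h x) _) _
          _ = _ := by
              rw [Real.exp_add, ENNReal.ofReal_mul (Real.exp_nonneg _)]
              ring
    _ = _ := by
        rw [ENNReal.tsum_add, ENNReal.tsum_mul_left, ENNReal.tsum_mul_right, P.tsum_coe, one_mul]

end ApproximateCloseness

/-! ### Privacy and accuracy of the algorithm -/

section Algorithm

variable {V : Type*} {G : SimpleGraph V}

/-- Edge weights read off from noisy roundings, shifted to overestimate the true weights. -/
noncomputable def noisyWeight (ε₁ t : ℝ) (N : G.edgeSet → ℕ) : EdgeWeights G :=
  fun e => Real.toNNReal ((N e + t) / ε₁)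

open Classical in
/-- The private algorithm for all-pairs shortest path distances: it samples `s` hubs, perturbs all
edge weights, and computes a private greedy spanner of the distances between hubs in `T` steps. -/
noncomputable def apsdPMF [Fintype V] [Nonempty V] [Fintype G.edgeSet] (k s T : ℕ) (ε₀ ε₁ t : ℝ) (w : EdgeWeights G) :
    PMF (Estimate V) :=
  (PMF.uniformOfFintype (Fin s → V)).bind fun f =>
    (noisyVector (fun e => ε₁ * (w e : ℝ)) Finset.univ.toList).bind fun N =>
      (greedySpanner G k (Finset.univ.image f) (fun x y => ε₀ * (wdist w x y).toReal) T
        (⊥, 0)).map fun st u v =>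
          (combineEstimate (noisyWeight ε₁ t N) (Finset.univ.image f)
            (fun a b => wdist (spannerWeight ε₀ t st) a b) u v : EReal)

/-- The hubs are independent of `w` and cost nothing. The noisy weights take `ε / 2`, the spanner
takes `ε / 2` and all of `δ`, and the estimates are post-processing. -/
theorem apsdPMF_approxClose [Fintype V] [Nonempty V] [Fintype G.edgeSet] {k s T : ℕ} {ε₀ ε₁ t ε δ a q : ℝ} (hε₀ : 0 < ε₀)
    (hε₁ : 0 ≤ ε₁) (hε₁ε : 4 * ε₁ ≤ ε / 2) (hδ : 0 < δ) (haq : a.HolderConjugate q)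
    (hT : T * (a * (Real.exp (4 * ε₀) - 1) ^ 2 / 2) ≤ ε / 2 / q - Real.log (1 / δ) / a)
    {w w' : EdgeWeights G} (h : Neighbors w w') :
    ApproxClose ε δ (apsdPMF k s T ε₀ ε₁ t w) (apsdPMF k s T ε₀ ε₁ t w') := by
  have he : ε = 0 + (ε / 2 + ε / 2) := by ring
  rw [he]
  refine ApproxClose.bind (PureClose.refl _) fun f => ApproxClose.bind
    ((noisyVector_pureClose _ _ _).mono ?_) fun N => ?_
  · rw [Finset.sum_map_toList]
    unfold Neighbors at h
    calc ∑ e, 4 * |ε₁ * (w e : ℝ) - ε₁ * (w' e : ℝ)|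
        = 4 * ε₁ * ∑ e, |(w e : ℝ) - (w' e : ℝ)| := by
          rw [Finset.mul_sum]
          refine Finset.sum_congr rfl fun e _ => ?_
          rw [← mul_sub, abs_mul, abs_of_nonneg hε₁]
          ring
      _ ≤ 4 * ε₁ * 1 := by gcongr
      _ ≤ _ := by linarith
  · intro S
    refine ((greedySpanner_renyiClose hε₀ haq (fun x y => ?_) T _).map _).toOuterMeasure_le
      haq hδ hT S
    rw [← mul_sub, abs_mul, abs_of_pos hε₀]
    exact mul_le_of_le_one_right hε₀.le (abs_wdist_sub_le h x y)

-- A shortest path with more than `2 * h` edges has end segments of `h + 1` vertices, each missed by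
-- the hubs with probability at most `β`. If `n ≤ 2 * h` no such path exists, so no hubs are needed.
open Classical in
theorem uniform_whp_hubSplit [Fintype V] [Nonempty V] (w : EdgeWeights G) (h s : ℕ) {β : ℝ}
    (hβ : Fintype.card V ≤ 2 * h ∨
      Real.exp (-((h + 1 : ℕ) * s / Fintype.card V)) ≤ β) :
    WHP (Fintype.card (V × V) * (ENNReal.ofReal β + ENNReal.ofReal β))
      (PMF.uniformOfFintype (Fin s → V))
      (fun f => ∀ u v, G.Reachable u v → HubSplit w h (Finset.univ.image f) u v) := by
  refine WHP.mono (WHP.forall (A := fun (p : V × V) (f : Fin s → V) =>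
    G.Reachable p.1 p.2 → HubSplit w h (Finset.univ.image f) p.1 p.2) fun p => ?_) le_rfl
    fun f hf u v => hf (u, v)
  obtain ⟨u, v⟩ := p
  have htriv : (∀ f : Fin s → V, G.Reachable u v → HubSplit w h (Finset.univ.image f) u v) →
      WHP (ENNReal.ofReal β + ENNReal.ofReal β) (PMF.uniformOfFintype (Fin s → V))
      (fun f => G.Reachable u v → HubSplit w h (Finset.univ.image f) u v) := by
    intro hall
    exact WHP.of_forall _ _ hall
  by_cases hr : G.Reachable u v
  · obtain ⟨p, hp, hpw⟩ := exists_isPath_walkWeight_eq w hr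
    by_cases hl : p.length ≤ 2 * h
    · exact htriv fun f _ => Or.inl ⟨p, hpw, hl⟩
    · push Not at hl
      have hβ' := hβ.resolve_left (by have := hp.length_lt; omega)
      obtain ⟨A, B, hA, hB, hAB⟩ := exists_segments hp hl
      have hhit : ∀ A : Finset V, A.card = h + 1 → WHP (ENNReal.ofReal β)
          (PMF.uniformOfFintype (Fin s → V)) (fun f => ∃ i, f i ∈ A) := fun A hA =>
        (uniform_whp_hits s A).mono (ENNReal.ofReal_le_ofReal (by rwa [hA])) fun _ h => h
      refine ((hhit A hA).and (hhit B hB)).mono le_rfl ?_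
      rintro f ⟨⟨i, hi⟩, ⟨j, hj⟩⟩ -
      obtain ⟨p₁, p₂, p₃, h1, h3, hpp⟩ := hAB _ hi _ hj
      exact Or.inr ⟨f i, by simp, f j, by simp, p₁, p₂, p₃, h1, h3, by rw [← hpp, hpw]⟩
  · exact htriv fun f h => absurd h hr

theorem le_noisyWeight {w : EdgeWeights G} {ε₁ t : ℝ} (hε₁ : 0 < ε₁) {N : G.edgeSet → ℕ}
    (hN : ∀ e, |ε₁ * (w e : ℝ) - N e| ≤ t) (e : G.edgeSet) : w e ≤ noisyWeight ε₁ t N e := by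
  unfold noisyWeight
  rw [← Real.toNNReal_coe (r := w e)]
  refine Real.toNNReal_le_toNNReal ?_
  rw [le_div_iff₀ hε₁]
  linarith [(abs_le.1 (hN e)).2]

theorem noisyWeight_le {w : EdgeWeights G} {ε₁ t : ℝ} (hε₁ : 0 < ε₁) (ht : 0 ≤ t)
    {N : G.edgeSet → ℕ} (hN : ∀ e, |ε₁ * (w e : ℝ) - N e| ≤ t) (e : G.edgeSet) :
    noisyWeight ε₁ t N e ≤ w e + Real.toNNReal (2 * t / ε₁) := by
  unfold noisyWeight
  rw [← Real.toNNReal_coe (r := w e), ← Real.toNNReal_add (w e).coe_nonneg (by positivity)]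
  refine Real.toNNReal_le_toNNReal ?_
  rw [div_le_iff₀ hε₁, add_mul, div_mul_cancel₀ _ hε₁.ne']
  linarith [(abs_le.1 (hN e)).1]

/-- The failure terms are two missed segments per pair of vertices, one noisy rounding per edge, and
`T` selections. For `s = 0` there are no hub distances to approximate, so `T` may be 0. -/
theorem apsdPMF_whp [Fintype V] [Nonempty V] [Fintype G.edgeSet] {k s T d h : ℕ} {ε₀ ε₁ t β β' : ℝ} (hk : 1 ≤ k)
    (hε₀ : 0 < ε₀) (hε₁ : 0 < ε₁) (ht : 0 ≤ t) (hd : s ≤ d ^ k) (hT : s ≠ 0 → d * s < T)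
    (hβ : Fintype.card V ≤ 2 * h ∨ Real.exp (-((h + 1 : ℕ) * s / Fintype.card V)) ≤ β)
    (hβ0 : 0 ≤ β) (hβ' : 9 * Real.exp (2 - t / 2) ≤ β') (w : EdgeWeights G) :
    WHP (ENNReal.ofReal ((Fintype.card V) ^ 2 * (2 * β + (1 + T) * β')))
      (apsdPMF k s T ε₀ ε₁ t w)
      (IsAccurate w (2 * (k : ℝ) - 1) (4 * h * t / ε₁ + (2 * k - 1) * (2 * t / ε₀))) := by
  classical
  have hβ'0 : 0 ≤ β' := le_trans (by positivity) hβ'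
  set X : V → V → ℝ := fun x y => ε₀ * (wdist w x y).toReal with hX
  refine WHP.mono ((uniform_whp_hubSplit w h s hβ).bind fun f hf => WHP.bind
    (A := fun N => ∀ e, |ε₁ * (w e : ℝ) - N e| ≤ t)
    (WHP.mono (noisyVector_whp (y := fun e => ε₁ * (w e : ℝ)) (fun e => by positivity) t
      Finset.univ.toList) (β' := (Fintype.card V ^ 2 : ℕ) * ENNReal.ofReal β') ?_
      fun N hN e => hN e (by simp)) fun N hN => WHP.map
    (WHP.mono (greedySpanner_whp hk (S := Finset.univ.image f) (X := X)
      (fun x y => by positivity)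
      (fun x y => by simp only [hX]; rw [wdist_comm]) t T 0 (GreedyInv.init G k _ X t 0))
      (β' := T * ((Fintype.card V ^ 2 : ℕ) * ENNReal.ofReal β')) ?_ fun st hst => ?_)) ?_
      fun _ h => h
  · rw [Finset.length_toList, Finset.card_univ]
    have : Fintype.card G.edgeSet ≤ Fintype.card V ^ 2 := by
      have h1 := G.card_edgeFinset_le_card_choose_two
      rw [SimpleGraph.edgeFinset_card] at h1
      exact h1.trans (Nat.choose_le_pow _ _)
    gcongr
  · gcongr
  · rw [zero_add] at hst
    have hcard : (Finset.univ.image f).card ≤ s := Finset.card_image_le.trans (by simp)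
    have hdS : (Finset.univ.image f).card ≤ d ^ k := hcard.trans hd
    have hTS : ∀ a ∈ Finset.univ.image f, d * (Finset.univ.image f).card < T := fun a ha =>
      lt_of_le_of_lt (Nat.mul_le_mul_left d hcard) (hT fun hs => by
        subst hs
        simp at ha)
    have hk1 : (1 : ℝ) ≤ k := by exact_mod_cast hk
    have hγ : 2 * (k : ℝ) - 1 = ((2 * k - 1 : ℕ) : ℝ) := by
      rw [Nat.cast_sub (by omega)]
      push_cast
      ring
    have hα1 : 0 ≤ 4 * h * t / ε₁ := by positivity
    have hα2 : 0 ≤ (2 * (k : ℝ) - 1) * (2 * t / ε₀) :=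
      mul_nonneg (by linarith) (by positivity)
    refine isAccurate_of_le hγ (add_nonneg hα1 hα2) (wdist_le_combineEstimate
      (le_noisyWeight hε₁ hN) _ fun a b => hst.wdist_le_wdist hε₀ a b) (fun u v huv => ?_)
      (by omega)
    refine (combineEstimate_le (noisyWeight_le hε₁ ht hN) (K := 2 * k - 1) (by omega)
      (fun a ha b hb hab => hst.wdist_le_mul hε₀ ht hk hdS (hTS a ha) ha hb hab) (hf u v huv)).trans ?_
    refine add_le_add_right (le_of_eq ?_) _
    rw [ENNReal.ofReal_add hα1 hα2, hγ, ENNReal.ofReal_mul (by positivity), ENNReal.ofReal_natCast]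
    congr 1
    rw [show 4 * (h : ℝ) * t / ε₁ = ((2 * h : ℕ) : ℝ) * (2 * t / ε₁) by push_cast; ring,
      ENNReal.ofReal_mul (by positivity), ENNReal.ofReal_natCast]
    push_cast
    rfl
  · rw [ENNReal.ofReal_mul (by positivity), ENNReal.ofReal_add (by positivity) (by positivity),
      ENNReal.ofReal_mul (by positivity), ENNReal.ofReal_mul (by positivity),
      ENNReal.ofReal_add (by positivity) (by positivity), ENNReal.ofReal_natCast,
      ENNReal.ofReal_pow (by positivity), ENNReal.ofReal_natCast, Fintype.card_prod]
    refine le_of_eq ?_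
    push_cast
    simp only [ENNReal.ofReal_one, ENNReal.ofReal_ofNat]
    ring

/-- A discrete distribution as a probability measure. -/
noncomputable def _root_.PMF.toProbabilityMeasure {Ω : Type*} [MeasurableSpace Ω] (P : PMF Ω) :
    MeasureTheory.ProbabilityMeasure Ω :=
  ⟨P.toMeasure, inferInstance⟩

theorem isDP_of_approxClose {X Ω : Type*} [MeasurableSpace Ω] {nbr : X → X → Prop} {ε δ : ℝ}
    {M : X → PMF Ω} (h : ∀ x x', nbr x x' → ApproxClose ε δ (M x) (M x')) :
    IsDP nbr ε δ (fun x => (M x).toProbabilityMeasure) := by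
  intro x x' hx S hS
  change (M x).toMeasure S ≤ _ * (M x').toMeasure S + _
  rw [PMF.toMeasure_apply_eq_toOuterMeasure_apply _ hS,
    PMF.toMeasure_apply_eq_toOuterMeasure_apply _ hS]
  exact h x x' hx S

end Algorithm

/-! ### Privacy budget and balancing of the two errors -/

section Parameters

theorem one_half_le_log {x : ℝ} (hx : 2 ≤ x) : 1 / 2 ≤ Real.log x := by
  have := Real.log_two_gt_d9
  have := Real.log_le_log two_pos hx
  linarith

/-- The order `a = 1 + 4 * L / ε` makes the term `ε / 2 / q` equal to `2 * L / a`, so at least `L /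
a` remains after the `δ` term. The constant 40 brings the `T` selections down to `a * ε² / (50 *
L)`, which fits because `a * ε = ε + 4 * L ≤ 6 * L`. -/
theorem privacy_budget {ε δ : ℝ} (hε : 0 < ε) (hε1 : ε < 1) (hδ : 0 < δ) (hδ1 : δ < 1) {T : ℕ}
    (hT : 1 ≤ T) :
    T * ((1 + 4 * Real.log (2 / δ) / ε) *
      (Real.exp (4 * (ε / (40 * √(T * Real.log (2 / δ))))) - 1) ^ 2 / 2) ≤
      ε / 2 / Real.conjExponent (1 + 4 * Real.log (2 / δ) / ε) -
        Real.log (1 / δ) / (1 + 4 * Real.log (2 / δ) / ε) := by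
  set L := Real.log (2 / δ) with hL
  have hL0 : 0.69 ≤ L := by
    have h1 := Real.log_two_gt_d9
    have h2 : Real.log 2 ≤ L := Real.log_le_log two_pos (by rw [le_div_iff₀ hδ]; linarith)
    linarith
  have hLδ : Real.log (1 / δ) ≤ L :=
    Real.log_le_log (by positivity) (by gcongr; norm_num)
  have hT' : (1 : ℝ) ≤ T := by exact_mod_cast hT
  have hTL : 0.69 ≤ T * L := by nlinarith
  set r := √(T * L) with hr
  have hr2 : r ^ 2 = T * L := Real.sq_sqrt (by positivity)
  have hr0 : 0.8 ≤ r := Real.le_sqrt_of_sq_le (by norm_num; linarith)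
  set a := 1 + 4 * L / ε with ha
  have ha0 : 0 < a := by positivity
  have haε : a * ε = ε + 4 * L := by rw [ha]; field_simp
  set e := ε / (40 * r) with he
  have he0 : 0 ≤ e := by positivity
  have he1 : 4 * e ≤ 1 := by
    rw [he, ← mul_div_assoc, div_le_one (by positivity)]
    linarith
  have hb : Real.exp (4 * e) - 1 ≤ 8 * e := by
    have := Real.abs_exp_sub_one_le (x := 4 * e) (by rw [abs_of_nonneg (by positivity)]; exact he1)
    rw [abs_of_nonneg (by positivity : 0 ≤ 4 * e)] at this
    linarith [le_abs_self (Real.exp (4 * e) - 1)]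
  have hb0 : 0 ≤ Real.exp (4 * e) - 1 := by
    have := Real.add_one_le_exp (4 * e)
    linarith
  have hrhs : L / a ≤ ε / 2 / Real.conjExponent a - Real.log (1 / δ) / a := by
    have : ε / 2 / Real.conjExponent a = 2 * L / a := by
      rw [Real.conjExponent, show a - 1 = 4 * L / ε by rw [ha]; ring]
      field_simp
      ring
    rw [this, ← sub_div]
    gcongr
    linarith
  refine le_trans ?_ hrhs
  calc T * (a * (Real.exp (4 * e) - 1) ^ 2 / 2) ≤ T * (a * (8 * e) ^ 2 / 2) := by gcongr
    _ = a * ε ^ 2 / (50 * L) := by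
        have h1 : e ^ 2 = ε ^ 2 / (1600 * (T * L)) := by
          rw [he, div_pow, mul_pow, hr2]
          norm_num
        rw [mul_pow, h1]
        field_simp
        ring
    _ ≤ L / a := by
        rw [div_le_div_iff₀ (by positivity) ha0]
        have h2 : a * ε ≤ 6 * L := by rw [haε]; linarith
        have h3 : (a * ε) ^ 2 ≤ (6 * L) ^ 2 := by gcongr
        nlinarith

/-- The balanced number of hubs. -/
noncomputable def hubCount (κ n l L : ℝ) : ℝ := (n * l / √L) ^ (2 * κ / (3 * κ + 1))

/-- The balanced additive error, up to the factor `k / ε` and constants. -/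
noncomputable def balancedError (κ n l L : ℝ) : ℝ :=
  n ^ ((κ + 1) / (3 * κ + 1)) * l ^ ((4 * κ + 2) / (3 * κ + 1)) * L ^ (κ / (3 * κ + 1))

variable {κ n l L : ℝ}

/-- This and `mul_hubCount_rpow` say that the local and the spanner error coincide at `hubCount`.
After taking logarithms each is a linear identity between exponents. -/
theorem div_hubCount (hκ : 1 ≤ κ) (hn : 0 < n) (hl : 0 < l) (hL : 0 < L) :
    n / hubCount κ n l L * l ^ 2 = balancedError κ n l L := by
  unfold hubCount balancedError
  rw [Real.sqrt_eq_rpow, ← Real.exp_log hn, ← Real.exp_log hl, ← Real.exp_log hL]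
  generalize Real.log n = x
  generalize Real.log l = y
  generalize Real.log L = z
  simp only [← Real.exp_mul, ← Real.exp_add, ← Real.exp_sub, ← Real.exp_nat_mul]
  congr 1
  push_cast
  field_simp
  ring

theorem mul_hubCount_rpow (hκ : 1 ≤ κ) (hn : 0 < n) (hl : 0 < l) (hL : 0 < L) :
    l * hubCount κ n l L ^ ((κ + 1) / (2 * κ)) * √L = balancedError κ n l L := by
  unfold hubCount balancedError
  rw [Real.sqrt_eq_rpow, ← Real.exp_log hn, ← Real.exp_log hl, ← Real.exp_log hL]
  generalize Real.log n = x
  generalize Real.log l = y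
  generalize Real.log L = z
  simp only [← Real.exp_mul, ← Real.exp_add, ← Real.exp_sub]
  congr 1
  field_simp
  ring

theorem hubCount_le (hκ : 1 ≤ κ) (hn : 2 ≤ n) (hl : 1 / 2 ≤ l) (hL : 1 / 2 ≤ L) :
    hubCount κ n l L ≤ 2 * (n * l) := by
  have hnl : 1 ≤ n * l := by nlinarith
  have hsq : 1 / 2 ≤ √L := Real.le_sqrt_of_sq_le (by linarith)
  have hy : n * l / √L ≤ 2 * (n * l) := by
    rw [div_le_iff₀ (by linarith)]
    nlinarith
  have he : 2 * κ / (3 * κ + 1) ≤ 1 := by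
    rw [div_le_one (by linarith)]
    linarith
  unfold hubCount
  calc (n * l / √L) ^ (2 * κ / (3 * κ + 1)) ≤ (2 * (n * l)) ^ (2 * κ / (3 * κ + 1)) :=
        Real.rpow_le_rpow (by positivity) hy (by positivity)
    _ ≤ (2 * (n * l)) ^ (1 : ℝ) := Real.rpow_le_rpow_of_exponent_le (by linarith) he
    _ = _ := Real.rpow_one _

/-- The claimed power of `log n` exceeds the balanced one by `κ / (3 * κ + 1) ≤ 1`; the surplus
factor is at least `1 / 2`. -/
theorem balancedError_le (hκ : 1 ≤ κ) (hn : 0 < n) (hl : 1 / 2 ≤ l) (hL : 0 < L) :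
    balancedError κ n l L ≤ 2 * (n ^ ((κ + 1) / (3 * κ + 1)) * l ^ ((5 * κ + 2) / (3 * κ + 1)) *
      L ^ (κ / (3 * κ + 1))) := by
  unfold balancedError
  have hl0 : 0 < l := by linarith
  have h1 : l ^ ((5 * κ + 2) / (3 * κ + 1)) =
      l ^ ((4 * κ + 2) / (3 * κ + 1)) * l ^ (κ / (3 * κ + 1)) := by
    rw [← Real.rpow_add hl0]
    congr 1
    ring
  have h2 : 1 / 2 ≤ l ^ (κ / (3 * κ + 1)) := by
    calc (1 / 2 : ℝ) = (1 / 2 : ℝ) ^ (1 : ℝ) := (Real.rpow_one _).symm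
      _ ≤ (1 / 2 : ℝ) ^ (κ / (3 * κ + 1)) :=
          Real.rpow_le_rpow_of_exponent_ge (by norm_num) (by norm_num)
            (by rw [div_le_one (by linarith)]; linarith)
      _ ≤ _ := Real.rpow_le_rpow (by norm_num) hl (by positivity)
  rw [h1]
  have h3 : 0 < n ^ ((κ + 1) / (3 * κ + 1)) * l ^ ((4 * κ + 2) / (3 * κ + 1)) *
    L ^ (κ / (3 * κ + 1)) := by positivity
  nlinarith

/-- The threshold `t = 2 * (c + 17) * log n` yields `n ^ (-(c + 17))`, of which `n ^ (-7) ≤ 1 / 128`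
absorbs `9 * exp 2 ≤ 72`. -/
theorem nine_mul_exp_le {c : ℝ} (hn : 2 ≤ n) :
    9 * Real.exp (2 - 2 * (c + 17) * Real.log n / 2) ≤ n ^ (-(c + 10)) := by
  have hn0 : 0 < n := by linarith
  have h1 : Real.exp (2 - 2 * (c + 17) * Real.log n / 2) =
      Real.exp 2 * (n ^ (-(7 : ℝ)) * n ^ (-(c + 10))) := by
    rw [← Real.rpow_add hn0, Real.rpow_def_of_pos hn0, ← Real.exp_add]
    congr 1
    ring
  have h2 : Real.exp 2 ≤ 8 := by
    have h := Real.exp_one_lt_d9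
    have : Real.exp 2 = Real.exp 1 ^ 2 := by rw [← Real.exp_nat_mul]; norm_num
    rw [this]
    have : Real.exp 1 ^ 2 ≤ 2.8 ^ 2 := by
      gcongr
      linarith
    norm_num at this ⊢
    linarith
  have h3 : 72 * n ^ (-(7 : ℝ)) ≤ 1 := by
    rw [Real.rpow_neg hn0.le, ← div_eq_mul_inv, div_le_one (by positivity)]
    have : (2 : ℝ) ^ (7 : ℝ) ≤ n ^ (7 : ℝ) := Real.rpow_le_rpow (by norm_num) hn (by norm_num)
    norm_num at this
    norm_num
    linarith
  have h4 : 0 < n ^ (-(c + 10)) := by positivity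
  have h5 : 0 < n ^ (-(7 : ℝ)) := by positivity
  rw [h1]
  calc 9 * (Real.exp 2 * (n ^ (-(7 : ℝ)) * n ^ (-(c + 10))))
      = (9 * Real.exp 2) * (n ^ (-(7 : ℝ)) * n ^ (-(c + 10))) := by ring
    _ ≤ 72 * (n ^ (-(7 : ℝ)) * n ^ (-(c + 10))) := by
        gcongr
        linarith
    _ = (72 * n ^ (-(7 : ℝ))) * n ^ (-(c + 10)) := by ring
    _ ≤ 1 * n ^ (-(c + 10)) := by gcongr
    _ = _ := one_mul _

theorem failure_le {c : ℝ} (hn : 2 ≤ n) {T : ℝ} (hT : T ≤ 4 * n ^ 4 + 1) :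
    n ^ 2 * (2 * n ^ (-(c + 10)) + (1 + T) * n ^ (-(c + 10))) ≤ n ^ (-c) := by
  have hn0 : 0 < n := by linarith
  have h1 : n ^ (-c) = n ^ 10 * n ^ (-(c + 10)) := by
    rw [← Real.rpow_natCast, ← Real.rpow_add hn0]
    congr 1
    push_cast
    ring
  have h4 : 0 < n ^ (-(c + 10)) := by positivity
  have h2 : 4 ≤ n ^ 2 := by nlinarith
  have h5 : 3 + T ≤ n ^ 8 := by
    have e1 : n ^ 4 = (n ^ 2) ^ 2 := by ring
    have e2 : n ^ 8 = (n ^ 2) ^ 4 := by ring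
    rw [e2]
    rw [e1] at hT
    generalize n ^ 2 = z at *
    have : 16 ≤ z ^ 2 := by nlinarith
    have e3 : z ^ 4 = z ^ 2 * z ^ 2 := by ring
    nlinarith
  calc n ^ 2 * (2 * n ^ (-(c + 10)) + (1 + T) * n ^ (-(c + 10)))
      = n ^ 2 * (3 + T) * n ^ (-(c + 10)) := by ring
    _ ≤ n ^ 2 * n ^ 8 * n ^ (-(c + 10)) := by gcongr
    _ = _ := by rw [h1]; ring

end Parameters

/-! ### Choice of hubs, steps and hop bound -/

section Parameters

theorem mul_balancedError_le_additiveError {k n : ℕ} {ε δ : ℝ} (hk : 1 ≤ k) (hn : 2 ≤ n)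
    (hε : 0 < ε) (hL : 0 < Real.log (2 / δ)) :
    k * balancedError k n (Real.log n) (Real.log (2 / δ)) / ε ≤ 2 * additiveError k n ε δ := by
  have h := balancedError_le (κ := k) (n := n) (l := Real.log n) (by exact_mod_cast hk)
    (by exact_mod_cast (by omega : 0 < n)) (one_half_le_log (by exact_mod_cast hn)) hL
  unfold additiveError
  rw [← mul_div_assoc]
  refine div_le_div_of_nonneg_right ?_ hε.le
  have := mul_le_mul_of_nonneg_left h (Nat.cast_nonneg (α := ℝ) k)
  linarith

theorem exists_hop_bound {c n l x : ℝ} (hc : 0 < c) (hn : 0 < n) (hl : 0 < l) (hx : 0 < x)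
    (hxn : x ≤ 2 * (n * l)) :
    ∃ h : ℕ, 2 * (c + 10) * (n / x * l) ≤ h ∧ (h : ℝ) ≤ 4 * (c + 17) * (n / x * l) := by
  refine ⟨⌈2 * (c + 10) * (n / x * l)⌉₊, Nat.le_ceil _, ?_⟩
  have h1 : 1 / 2 ≤ n / x * l := by
    rw [div_mul_eq_mul_div, le_div_iff₀ hx]
    linarith
  have h2 := Nat.ceil_lt_add_one (a := 2 * (c + 10) * (n / x * l)) (by positivity)
  nlinarith

theorem ceil_rpow_bounds {k s : ℕ} (hk : 1 ≤ k) (hs : 1 ≤ s) :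
    s ≤ ⌈(s : ℝ) ^ (1 / (k : ℝ))⌉₊ ^ k ∧ ⌈(s : ℝ) ^ (1 / (k : ℝ))⌉₊ ≤ s ∧
      √((⌈(s : ℝ) ^ (1 / (k : ℝ))⌉₊ * s + 1 : ℕ) : ℝ) ≤ 2 * (s : ℝ) ^ (((k : ℝ) + 1) / (2 * k)) := by
  have hk' : (1 : ℝ) ≤ k := by exact_mod_cast hk
  have hs' : (1 : ℝ) ≤ s := by exact_mod_cast hs
  have hs0 : (0 : ℝ) < s := by linarith
  set r := (s : ℝ) ^ (1 / (k : ℝ)) with hr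
  have hr1 : 1 ≤ r := Real.one_le_rpow hs' (by positivity)
  have hrk : r ^ k = s := by
    rw [hr, ← Real.rpow_natCast, ← Real.rpow_mul hs0.le, one_div_mul_cancel (by positivity),
      Real.rpow_one]
  refine ⟨?_, ?_, ?_⟩
  · have : (s : ℝ) ≤ (⌈r⌉₊ : ℝ) ^ k := by
      rw [← hrk]
      exact pow_le_pow_left₀ (by linarith) (Nat.le_ceil r) k
    exact_mod_cast this
  · rw [Nat.ceil_le, hr]
    calc (s : ℝ) ^ (1 / (k : ℝ)) ≤ (s : ℝ) ^ (1 : ℝ) :=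
          Real.rpow_le_rpow_of_exponent_le hs' (by rw [div_le_one (by linarith)]; exact hk')
      _ = s := Real.rpow_one _
  · refine Real.sqrt_le_iff.2 ⟨by positivity, ?_⟩
    have hsq : ((s : ℝ) ^ (((k : ℝ) + 1) / (2 * k))) ^ 2 = r * s := by
      rw [← Real.rpow_natCast, ← Real.rpow_mul hs0.le, hr]
      nth_rewrite 3 [← Real.rpow_one (s : ℝ)]
      rw [← Real.rpow_add hs0]
      congr 1
      push_cast
      field_simp
      ring
    have hceil := Nat.ceil_lt_add_one (a := r) (by linarith)
    push_cast
    rw [mul_pow, hsq]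
    nlinarith

theorem two_mul_mul_div_eq {ε r : ℝ} (hε : ε ≠ 0) (hr : r ≠ 0) (k c l : ℝ) :
    (2 * k) * (2 * (2 * (c + 17) * l) / (ε / (40 * r))) =
      320 * (c + 17) * (k * (l * r) / ε) := by
  field_simp
  ring

theorem exists_parameters {c : ℝ} (hc : 0 < c) {k n : ℕ} (hk : 1 ≤ k) (hn : 2 ≤ n) {ε δ : ℝ}
    (hε : 0 < ε) (hε1 : ε < 1) (hδ : 0 < δ) (hδ1 : δ < 1) :
    ∃ (s T d h : ℕ) (ε₀ a q : ℝ), 0 < ε₀ ∧ s ≤ d ^ k ∧ (s ≠ 0 → d * s < T) ∧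
      (n ≤ 2 * h ∨ Real.exp (-((h + 1 : ℕ) * s / n)) ≤ (n : ℝ) ^ (-(c + 10))) ∧
      (T : ℝ) ≤ 4 * (n : ℝ) ^ 4 + 1 ∧ a.HolderConjugate q ∧
      T * (a * (Real.exp (4 * ε₀) - 1) ^ 2 / 2) ≤ ε / 2 / q - Real.log (1 / δ) / a ∧
      4 * h * (2 * (c + 17) * Real.log n) / (ε / 8) +
        (2 * k - 1) * (2 * (2 * (c + 17) * Real.log n) / ε₀) ≤
        600 * (c + 17) ^ 2 * additiveError k n ε δ := by
  have hk' : (1 : ℝ) ≤ k := by exact_mod_cast hk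
  have hn' : (2 : ℝ) ≤ n := by exact_mod_cast hn
  have hn0 : (0 : ℝ) < n := by linarith
  have hl : 1 / 2 ≤ Real.log n := one_half_le_log hn'
  have hln : Real.log n ≤ n := (Real.log_le_sub_one_of_pos hn0).trans (by linarith)
  have hL : 1 / 2 ≤ Real.log (2 / δ) :=
    one_half_le_log (by rw [le_div_iff₀ hδ]; linarith)
  have hadd := mul_balancedError_le_additiveError hk hn hε (by linarith : 0 < Real.log (2 / δ))
  have hdiv := div_hubCount hk' hn0 (by linarith : 0 < Real.log n)
    (by linarith : 0 < Real.log (2 / δ))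
  have hmul := mul_hubCount_rpow hk' hn0 (by linarith : 0 < Real.log n)
    (by linarith : 0 < Real.log (2 / δ))
  have hxle := hubCount_le hk' hn' hl hL
  have hx0 : 0 < hubCount k n (Real.log n) (Real.log (2 / δ)) := by
    unfold hubCount
    have : 0 < √(Real.log (2 / δ)) := Real.sqrt_pos.2 (by linarith)
    positivity
  have haq := Real.HolderConjugate.conjExponent
    (show 1 < 1 + 4 * Real.log (2 / δ) / ε from lt_add_of_pos_right _ (by positivity))
  have hLδ : Real.log (1 / δ) ≤ Real.log (2 / δ) :=
    Real.log_le_log (by positivity) (by gcongr; norm_num)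
  have hprivacy := fun {T : ℕ} => privacy_budget hε hε1 hδ hδ1 (T := T)
  generalize hA : balancedError k n (Real.log n) (Real.log (2 / δ)) = A at *
  generalize hx : hubCount k n (Real.log n) (Real.log (2 / δ)) = x at *
  generalize Real.log (2 / δ) = L at *
  generalize hlog : Real.log n = l at *
  have hl0 : 0 < l := by linarith
  have hA0 : 0 < A := by rw [← hdiv]; positivity
  obtain ⟨h, hh1, hh2⟩ := exists_hop_bound hc hn0 hl0 hx0 hxle
  have hfirst : 4 * h * (2 * (c + 17) * l) / (ε / 8) ≤ 256 * (c + 17) ^ 2 * (k * A / ε) := by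
    calc 4 * h * (2 * (c + 17) * l) / (ε / 8)
        ≤ 4 * (4 * (c + 17) * (n / x * l)) * (2 * (c + 17) * l) / (ε / 8) := by gcongr
      _ = 256 * (c + 17) ^ 2 * (1 * (n / x * l ^ 2) / ε) := by
          field_simp
          ring
      _ ≤ _ := by rw [hdiv]; gcongr
  -- Here `640 ≤ 44 * 17`, so the two errors add up to at most `(256 + 44) * (c + 17)²` times `k * A
  -- / ε`, and `hadd` doubles this to 600.
  have hfinal : ∀ z : ℝ, z ≤ 640 * (c + 17) * (k * A / ε) →
      4 * h * (2 * (c + 17) * l) / (ε / 8) + z ≤ 600 * (c + 17) ^ 2 * additiveError k n ε δ := by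
    intro z hz
    have h1 : 0 ≤ k * A / ε := by positivity
    have h2 : 640 * (c + 17) ≤ 44 * (c + 17) ^ 2 := by
      rw [pow_two, ← mul_assoc]
      exact mul_le_mul_of_nonneg_right (by linarith) (by linarith)
    have h3 := mul_le_mul_of_nonneg_right h2 h1
    have h4 := mul_le_mul_of_nonneg_left hadd (by positivity : 0 ≤ 300 * (c + 17) ^ 2)
    linarith
  rcases lt_or_ge x 1 with hx1 | hx1
  · have hnx : (n : ℝ) ≤ n / x := le_div_self hn0.le hx0 hx1.le
    -- Fewer than one hub is called for: then `h ≥ n`, every path is short, and neither hubs nor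
    -- spanner steps are used. The value of `ε₀` only has to keep the formal error term small.
    refine ⟨0, 0, 0, h, ε, 1 + 4 * L / ε, _, hε, Nat.zero_le _, by simp, Or.inl ?_,
      by push_cast; positivity, haq, ?_, hfinal _ ?_⟩
    · have h2 : (n : ℝ) ≤ h := by
        refine le_trans ?_ hh1
        calc (n : ℝ) = 2 * 1 * (n * (1 / 2)) := by ring
          _ ≤ 2 * (c + 10) * (n / x * l) := by
              gcongr
              linarith
      have : n ≤ h := by exact_mod_cast h2
      omega
    · have : ε / 2 / (1 + 4 * L / ε).conjExponent = 2 * L / (1 + 4 * L / ε) := by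
        rw [Real.conjExponent, show 1 + 4 * L / ε - 1 = 4 * L / ε by ring]
        field_simp
        ring
      rw [this, ← sub_div]
      simp only [Nat.cast_zero, zero_mul]
      exact div_nonneg (by linarith) (by positivity)
    · have h1 : l ≤ A := by
        rw [← hdiv]
        calc l = 2 * (1 / 2) * l := by ring
          _ ≤ n * l * l := by gcongr
          _ = n * l ^ 2 := by ring
          _ ≤ n / x * l ^ 2 := by gcongr
      calc (2 * (k : ℝ) - 1) * (2 * (2 * (c + 17) * l) / ε)
          ≤ (2 * k) * (2 * (2 * (c + 17) * A) / ε) := by gcongr; linarith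
        _ = 8 * (c + 17) * (k * A / ε) := by ring
        _ ≤ _ := by gcongr; norm_num
  · set s := ⌊x⌋₊ with hs
    have hs1 : 1 ≤ s := Nat.floor_pos.2 hx1
    have hsx : (s : ℝ) ≤ x := Nat.floor_le hx0.le
    have hxs : x ≤ 2 * s := by
      have := Nat.lt_floor_add_one x
      have : (1 : ℝ) ≤ s := by exact_mod_cast hs1
      linarith
    obtain ⟨hd1, hd2, hd3⟩ := ceil_rpow_bounds hk hs1
    set d := ⌈(s : ℝ) ^ (1 / (k : ℝ))⌉₊
    clear_value d
    set r := √(((d * s + 1 : ℕ) : ℝ) * L) with hr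
    have hr0 : 0 < r := Real.sqrt_pos.2 (by positivity)
    have hpr := hprivacy (T := d * s + 1) (Nat.le_add_left _ _)
    rw [← hr] at hpr
    clear_value r s
    refine ⟨s, d * s + 1, d, h, ε / (40 * r), 1 + 4 * L / ε, _, by positivity, hd1,
      fun _ => Nat.lt_succ_self _, Or.inr ?_, ?_, haq, hpr, hfinal _ ?_⟩
    · rw [Real.rpow_def_of_pos hn0, hlog]
      refine Real.exp_le_exp.2 ?_
      -- The factor 2 in the lower bound on `h` pays for rounding `x` down to `s ≥ x / 2`.
      have h1 : (c + 10) * l * n ≤ ((h + 1 : ℕ) : ℝ) * s := by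
        calc (c + 10) * l * n = 2 * (c + 10) * (n / x * l) * (x / 2) := by field_simp
          _ ≤ h * s := by
              gcongr
              linarith
          _ ≤ _ := by
              push_cast
              gcongr
              linarith
      have h2 := (le_div_iff₀ hn0).2 h1
      linarith
    · have h1 : (s : ℝ) ≤ 2 * (n : ℝ) ^ 2 := by
        rw [pow_two]
        exact (hsx.trans hxle).trans (by gcongr)
      have h2 : (d : ℝ) ≤ s := by exact_mod_cast hd2
      push_cast
      calc (d : ℝ) * s + 1 ≤ (2 * (n : ℝ) ^ 2) * (2 * (n : ℝ) ^ 2) + 1 := by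
            gcongr
            exact h2.trans h1
        _ = _ := by ring
    · have h1 : l * r ≤ 2 * A := by
        rw [hr, Real.sqrt_mul (by positivity), ← hmul]
        calc l * (√((d * s + 1 : ℕ) : ℝ) * √L)
            ≤ l * (2 * x ^ (((k : ℝ) + 1) / (2 * k)) * √L) := by
              gcongr
              exact hd3.trans (by gcongr)
          _ = _ := by ring
      calc (2 * (k : ℝ) - 1) * (2 * (2 * (c + 17) * l) / (ε / (40 * r)))
          ≤ (2 * k) * (2 * (2 * (c + 17) * l) / (ε / (40 * r))) := by gcongr; linarith
        _ = 320 * (c + 17) * (k * (l * r) / ε) := two_mul_mul_div_eq hε.ne' hr0.ne' _ _ _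
        _ ≤ 320 * (c + 17) * (k * (2 * A) / ε) := by gcongr
        _ = _ := by ring

end Parameters

theorem IsAccurate.mono {V : Type*} {G : SimpleGraph V} {w : EdgeWeights G} {γ α α' : ℝ}
    {est : Estimate V} (h : IsAccurate w γ α est) (hα : α ≤ α') : IsAccurate w γ α' est := by
  have hα' : (α : EReal) ≤ α' := EReal.coe_le_coe_iff.2 hα
  exact fun u v => ⟨(EReal.sub_le_sub le_rfl hα').trans (h u v).1,
    (h u v).2.trans (add_le_add le_rfl hα')⟩

end PrivateAPSD

theorem mainTheorem5 :
    ∀ c : ℝ, 0 < c → ∃ C : ℝ, 0 < C ∧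
      ∀ (k : ℕ), 1 ≤ k → ∀ (ε δ : ℝ), 0 < ε → ε < 1 → 0 < δ → δ < 1 →
      ∀ (V : Type*) [Fintype V] (G : SimpleGraph V) [Fintype G.edgeSet],
      ∃ M : PrivateAPSD.EdgeWeights G →
          MeasureTheory.ProbabilityMeasure (PrivateAPSD.Estimate V),
        PrivateAPSD.IsDP PrivateAPSD.Neighbors ε δ M ∧
        ∀ w : PrivateAPSD.EdgeWeights G,
          ENNReal.ofReal (1 - (Fintype.card V : ℝ) ^ (-c)) ≤
            (M w : MeasureTheory.Measure (PrivateAPSD.Estimate V))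
              {est | PrivateAPSD.IsAccurate w (2 * (k : ℝ) - 1)
                (C * PrivateAPSD.additiveError k (Fintype.card V) ε δ) est} := by
  intro c hc
  refine ⟨600 * (c + 17) ^ 2, by positivity, ?_⟩
  intro k hk ε δ hε hε1 hδ hδ1 V _ G _
  -- For `n < 2` a constant output suffices: with no vertices accuracy is vacuous, and with one
  -- vertex the required probability `1 - 1 ^ (-c)` is 0.
  rcases Nat.lt_or_ge (Fintype.card V) 2 with hn | hn
  · refine ⟨fun _ => (PMF.pure fun _ _ => 0).toProbabilityMeasure, ?_, fun w => ?_⟩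
    · refine PrivateAPSD.isDP_of_approxClose fun _ _ _ S => ?_
      refine le_trans (le_mul_of_one_le_left' ?_) le_self_add
      rw [ENNReal.one_le_ofReal, Real.one_le_exp_iff]
      exact hε.le
    · rcases (by omega : Fintype.card V = 0 ∨ Fintype.card V = 1) with h0 | h1
      · have := Fintype.card_eq_zero_iff.1 h0
        have huniv : {est : PrivateAPSD.Estimate V | PrivateAPSD.IsAccurate w (2 * (k : ℝ) - 1)
            (600 * (c + 17) ^ 2 * PrivateAPSD.additiveError k (Fintype.card V) ε δ) est} =
            Set.univ := Set.eq_univ_of_forall fun est u => isEmptyElim u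
        rw [huniv, MeasureTheory.measure_univ]
        refine ENNReal.ofReal_le_one.2 ?_
        have : (0 : ℝ) ≤ (Fintype.card V : ℝ) ^ (-c) := by positivity
        linarith
      · rw [h1]
        simp
  · have : Nonempty V := Fintype.card_pos_iff.1 (by omega)
    have hn' : (2 : ℝ) ≤ Fintype.card V := by exact_mod_cast hn
    obtain ⟨s, T, d, h, ε₀, a, q, hε₀, hd, hT, hβ, hT4, haq, hpriv, hα⟩ :=
      PrivateAPSD.exists_parameters hc hk hn hε hε1 hδ hδ1
    refine ⟨fun w => (PrivateAPSD.apsdPMF k s T ε₀ (ε / 8)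
      (2 * (c + 17) * Real.log (Fintype.card V)) w).toProbabilityMeasure,
      PrivateAPSD.isDP_of_approxClose fun w w' hw =>
        PrivateAPSD.apsdPMF_approxClose hε₀ (by positivity) (by linarith) hδ haq hpriv hw,
      fun w => ?_⟩
    have hlog : 0 ≤ Real.log (Fintype.card V) := Real.log_natCast_nonneg _
    refine PrivateAPSD.WHP.one_sub_le_toMeasure (by positivity)
      ((PrivateAPSD.apsdPMF_whp hk hε₀ (by positivity) (by positivity) hd hT hβ (by positivity)
        (PrivateAPSD.nine_mul_exp_le hn') w).mono (ENNReal.ofReal_le_ofReal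
          (PrivateAPSD.failure_le hn' hT4)) fun est hest => hest.mono hα)
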